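/- Work with subsets of $\omega$ modulo finite sets: a family of subsets of $\omega$ is *centered* if each of its finite subfamilies has infinite intersection; write $a^1=a$ and $a^0=\omega\setminus a$, and $a\subseteq^* b$ if $a\setminus b$ is finite. For a set $X$ let $\mathbf C_X$ be the set of finite partial functions from $X$ to $2$; a set $D\subseteq\mathbf C_X$ is *dense* if each $h\in\mathbf C_X$ is extended by some $g\in D$; for dense $C,D\subseteq\mathbf C_X$, $C$ *refines* $D$ if each $h\in C$ extends some $g\in D$. A set $\mathcal A$ of infinite subsets of $\omega$ is an *independent system* if $\{a^{f(a)}\mid a\in\mathcal A\}$ is centered for every $f\colon\mathcal A\to 2$. For $h\in\mathbf C_{\mathcal A}$ put $\mathcal A^h=\bigcap\{a^{h(a)}\mid a\in\operatorname{dom}h\}$ (with $\mathcal A^\emptyset=\omega$). The system $\mathcal A$ is *dense* if for each $X\subseteq\omega$ the set of those $h$ with $\mathcal A^h\subseteq^* X$ or $\mathcal A^h\cap X$ finite is dense in $\mathbf C_{\mathcal A}$. Let $\mathscr F_{\mathcal A}$ be the filter on $\omega$ generated by the sets $\bigcup\{\mathcal A^h\mid h\in D\}$, where $D$ runs over the dense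 subsets of $\mathbf C_{\mathcal A}$. A sequence $B=\langle a_\alpha\mid\alpha<\gamma\rangle$ of subsets of $\omega$, $\gamma$ an ordinal, is a *free sequence* if for each $\beta\le\gamma$ the family $\{a_\alpha\mid\alpha<\beta\}\cup\{\omega\setminus a_\alpha\mid\beta\le\alpha<\gamma\}$ is centered. It is *maximal* if there is no $X\subseteq\omega$ for which the end-extension $B^\frown\langle X\rangle$ is a free sequence. For a dense independent system $\mathcal A$, a free sequence $B$ is *associated with* $\mathcal A$ if $B$ is maximal and the sets $a_\alpha$ together with the cofinite sets generate the filter $\mathscr F_{\mathcal A}$. **Theorem.** Let $V\subseteq W$ be transitive models (sets or classes) of ZFC. Let $\mathcal A\in V$ be a dense independent system in $V$, and let $B\in V$ be, in $V$, a maximal free sequence associated with $\mathcal A$. Suppose that - $W$ is a *Cohen-preserving* extension of $V$: each dense $D\subseteq\mathbf C_\omega$ with $D\in W$ is refined by some dense $C\subseteq\mathbf C_\omega$ with $C\in V$; - each subset of $\mathcal A$ that belongs to $W$ and is countable in $W$ is contained in a set that belongs to $V$ and is countable in $V$ (this holds, for instance, if $W$ is a generic extension of $V$ by a proper forcing); -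 $\mathcal A$ remains a dense independent system in $W$. Then, in $W$, $B$ is a maximal free sequence associated with $\mathcal A$. -/

import Mathlib

universe u

noncomputable section

/-! ### Transitive models of ZFC -/

/-- The only symbol of the language of set theory: a binary relation. -/
inductive MemRel : ℕ → Type
  | mem : MemRel 2

/-- The first-order language of set theory. -/
def setLanguage : FirstOrder.Language := ⟨fun _ => Empty, MemRel⟩

/-- A type with a binary relation `E`, as a structure for the language of set theory. -/
@[reducible] def setStructure {α : Type*} (E : α → α → Prop) : setLanguage.Structure α where
  funMap := fun f => f.elim
  RelMap := fun r => match r with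
    | .mem => fun x => E (x 0) (x 1)

/-- `(α, E)` satisfies every axiom of ZFC. The two schemes range over all formulas of the
language of set theory, with arbitrary parameters from `α`. -/
structure ModelsZFC {α : Type*} (E : α → α → Prop) : Prop where
  nonempty : Nonempty α
  extensionality : ∀ x y, (∀ z, E z x ↔ E z y) → x = y
  foundation : ∀ x, (∃ y, E y x) → ∃ y, E y x ∧ ∀ z, E z x → ¬ E z y
  pairing : ∀ x y, ∃ p, ∀ z, E z p ↔ z = x ∨ z = y
  union : ∀ x, ∃ s, ∀ z, E z s ↔ ∃ y, E y x ∧ E z y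
  powerset : ∀ x, ∃ p, ∀ y, E y p ↔ ∀ z, E z y → E z x
  infinity : ∃ x, (∃ e, E e x ∧ ∀ z, ¬ E z e) ∧
    ∀ y, E y x → ∃ s, E s x ∧ ∀ z, E z s ↔ E z y ∨ z = y
  separation : letI := setStructure E
    ∀ S : Set α, (Set.univ : Set α).Definable₁ setLanguage S →
      ∀ x, ∃ y, ∀ z, E z y ↔ E z x ∧ z ∈ S
  replacement : letI := setStructure E
    ∀ R : Set (α × α), (Set.univ : Set α).Definable₂ setLanguage R →
      ∀ x, (∀ y, E y x → ∀ z z', (y, z) ∈ R → (y, z') ∈ R → z = z') →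
        ∃ w, ∀ z, E z w ↔ ∃ y, E y x ∧ (y, z) ∈ R
  choice : ∀ x, (∀ y, E y x → ∃ z, E z y) →
    (∀ y y', E y x → E y' x → (∃ z, E z y ∧ E z y') → y = y') →
      ∃ c, ∀ y, E y x → ∃! z, E z y ∧ E z c

/-- A transitive class (possibly a set) `M` of sets that, with the true membership relation, is a
model of ZFC. -/
structure IsTransitiveModel (M : Set ZFSet.{u}) : Prop where
  transitive : ∀ x ∈ M, ∀ y ∈ x, y ∈ M
  models : ModelsZFC (fun x y : M => x.1 ∈ y.1)

/-! ### Subsets of `ω` -/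

/-- The von Neumann numeral `n`. -/
def numeral : ℕ → ZFSet.{u}
  | 0 => ∅
  | n + 1 => insert (numeral n) (numeral n)

/-- The set of natural numbers coded by a set `x ⊆ ω`. -/
def natSet (x : ZFSet.{u}) : Set ℕ := {n | numeral n ∈ x}

/-- A family of subsets of `ω` is centered, as a family in `P(ω)/fin`: every finite subfamily has
infinite intersection. -/
def Centered (S : Set (Set ℕ)) : Prop :=
  ∀ T ⊆ S, T.Finite → (⋂₀ T).Infinite

/-! ### Cohen posets -/

/-- `h` is a finite partial function from `X` to `2 = {0, 1}`, i.e. an element of the Cohen poset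
`C_X`. -/
def IsCohen (X h : ZFSet.{u}) : Prop :=
  h ⊆ ZFSet.prod X {numeral 0, numeral 1} ∧ (h : Set ZFSet.{u}).Finite ∧
    ∀ x i j, ZFSet.pair x i ∈ h → ZFSet.pair x j ∈ h → i = j

/-- `D` is a dense subset of `C_X` (ordered by reverse inclusion). -/
def IsCohenDense (X D : ZFSet.{u}) : Prop :=
  (∀ h ∈ D, IsCohen X h) ∧ ∀ h, IsCohen X h → ∃ g ∈ D, h ⊆ g

/-- `C` refines `D`. -/
def Refines (C D : ZFSet.{u}) : Prop :=
  ∀ h ∈ C, ∃ g ∈ D, g ⊆ h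

/-- `W` is Cohen-preserving over `V`: every dense subset of `C = C_ω` in `W` is refined by a dense
subset of `C` in `V`. -/
def CohenPreserving (V W : Set ZFSet.{u}) : Prop :=
  ∀ D ∈ W, IsCohenDense ZFSet.omega D → ∃ C ∈ V, IsCohenDense ZFSet.omega C ∧ Refines C D

/-- `x` is countable in `M`: some injection of `x` into `ω` is an element of `M`. -/
def CountableIn (M : Set ZFSet.{u}) (x : ZFSet.{u}) : Prop :=
  ∃ f ∈ M, ZFSet.IsFunc x ZFSet.omega f ∧
    ∀ y z n, ZFSet.pair y n ∈ f → ZFSet.pair z n ∈ f → y = z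

/-- Countable covering for subsets of `X`: every subset of `X` that belongs to `W` and is countable
there is contained in a set that belongs to `V` and is countable in `V`. -/
def CountableCovering (V W : Set ZFSet.{u}) (X : ZFSet.{u}) : Prop :=
  ∀ a ∈ W, a ⊆ X → CountableIn W a → ∃ b ∈ V, CountableIn V b ∧ a ⊆ b

/-! ### Independent systems -/

/-- `A` is an independent system: a set of infinite subsets of `ω` such that
`{a ^ f(a) | a ∈ A}` is centered for every `f : A → 2`. -/
def IsIndependent (A : ZFSet.{u}) : Prop :=
  (∀ a ∈ A, a ⊆ ZFSet.omega ∧ (natSet a).Infinite) ∧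
    ∀ f : ZFSet.{u} → Bool,
      Centered {s | ∃ a ∈ A, s = if f a = true then natSet a else (natSet a)ᶜ}

/-- The set `A ^ h = ⋂ {a ^ h(a) | a ∈ dom h}` for a finite partial function `h` from `A` to `2`
(all of `ω` if `h` is empty). -/
def cohenInter (h : ZFSet.{u}) : Set ℕ :=
  {n | ∀ a, (ZFSet.pair a (numeral 1) ∈ h → n ∈ natSet a) ∧
    (ZFSet.pair a (numeral 0) ∈ h → n ∉ natSet a)}

/-- `h` reaps `X`: either `A ^ h ⊆* X` or `A ^ h ∩ X =* ∅`. -/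
def Reaps (h X : ZFSet.{u}) : Prop :=
  (cohenInter h \ natSet X).Finite ∨ (cohenInter h ∩ natSet X).Finite

/-- `A` is a dense independent system in the model `M`: it is independent and, for each `X ⊆ ω` in
`M`, the finite partial functions that reap `X` are dense in `C_A`. -/
def IsDenseSystem (M : Set ZFSet.{u}) (A : ZFSet.{u}) : Prop :=
  IsIndependent A ∧ ∀ X ∈ M, X ⊆ ZFSet.omega →
    ∀ h, IsCohen A h → ∃ g, IsCohen A g ∧ h ⊆ g ∧ Reaps g X

/-- The filter generated by the sets `F(D) = ⋃ {A ^ h | h ∈ D}`, for `D` a dense subset of `C_A`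
in `M`. The filter `F_A` as computed in `M` consists of its elements that belong to `M`. -/
def densityFilter (M : Set ZFSet.{u}) (A : ZFSet.{u}) : Filter ℕ :=
  Filter.generate {S | ∃ D ∈ M, IsCohenDense A D ∧ S = {n | ∃ h ∈ D, n ∈ cohenInter h}}

/-! ### Free sequences -/

/-- `B = ⟨a_α | α < γ⟩` is a free sequence (of ordinal length `γ`) in `P(ω)/fin`: for each `β ≤ γ`
the family `{a_α | α < β} ∪ {ω \ a_α | β ≤ α < γ}` is centered. -/
def IsFreeSequence (γ B : ZFSet.{u}) : Prop :=
  γ.IsOrdinal ∧ ZFSet.IsFunc γ (ZFSet.powerset ZFSet.omega) B ∧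
    ∀ β, β ∈ γ ∨ β = γ →
      Centered {s | ∃ α a, ZFSet.pair α a ∈ B ∧
        ((α ∈ β ∧ s = natSet a) ∨ (α ∉ β ∧ s = (natSet a)ᶜ))}

/-- `B` is a maximal free sequence in `M`: no end-extension of `B` by one further set
`X ⊆ ω` in `M` is a free sequence. -/
def IsMaximalFreeSequence (M : Set ZFSet.{u}) (γ B : ZFSet.{u}) : Prop :=
  IsFreeSequence γ B ∧ ∀ X ∈ M, X ⊆ ZFSet.omega →
    ¬ IsFreeSequence (insert γ γ) (insert (ZFSet.pair γ X) B)

/-- The filter on `ω` generated by the terms of `B` in `P(ω)/fin`, i.e. together with the cofinite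
sets. -/
def sequenceFilter (B : ZFSet.{u}) : Filter ℕ :=
  Filter.generate ({S | ∃ α a, ZFSet.pair α a ∈ B ∧ S = natSet a} ∪ {S | Sᶜ.Finite})

/-- In `M`, `B` is a free sequence associated with `A`: it is a maximal free sequence and it
generates the filter `F_A`. -/
def IsAssociated (M : Set ZFSet.{u}) (A γ B : ZFSet.{u}) : Prop :=
  IsMaximalFreeSequence M γ B ∧
    ∀ X ∈ M, X ⊆ ZFSet.omega → (natSet X ∈ sequenceFilter B ↔ natSet X ∈ densityFilter M A)

end

/-! The two filters do not change between the models. `sequenceFilter B` mentions no model, so the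
point is that F_A computed in W and in V generate the same filter (`densityFilter_eq`). For this
each dense D ⊆ C_A in W must be refined by a dense set in V (`exists_refines_of_cohenPreserving`).
In W, close off to get a countable b ⊆ A such that the conditions of D living on b are dense in C_b
(`exists_countable_dense`). Countable covering gives an injection f ∈ V of a superset of b into ω.
Transport D along f to C_ω, refine it there by Cohen preservation, and pull the refinement back to
C_A inside V.

For maximality, suppose X ∈ W end-extends B. Some h has A^h ⊆* X. Otherwise, as A is dense in W, the
conditions h with A^h disjoint from X are dense, so ω \ X lies in F_A, hence almost contains a
finite intersection of terms of B, which contradicts freeness of B⌢X. Now Y = A^h is in V even if X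
is not. It is positive for F_A by independence and Y ⊆* X, so B⌢Y is free
(`IsFreeSequence.insert_of_subset`), against maximality of B in V.

The rest places the auxiliary sets in the models. ZFC holds there only as first-order axioms, so
each set is cut out by separation from a formula. `Dfn` and `Trm` are a calculus for such formulas;
a bound variable is coordinate 0, the others being shifted up. -/

/-! ### Definability over a transitive class -/

/-- A class of sets as a structure for the language of set theory. -/
@[reducible] instance memStructure (M : Set ZFSet.{u}) : setLanguage.Structure M :=
  setStructure fun x y : M => x.1 ∈ y.1

/-- `P` is definable with parameters over `(M, ∈)`, as a relation on `M`. -/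
def Dfn (M : Set ZFSet.{u}) {n : ℕ} (P : (Fin n → ZFSet.{u}) → Prop) : Prop :=
  (Set.univ : Set M).Definable setLanguage {v : Fin n → M | P fun i => (v i).1}

/-- `T` is an operation on `M` that is definable with parameters over `(M, ∈)`. -/
def Trm (M : Set ZFSet.{u}) {n : ℕ} (T : (Fin n → ZFSet.{u}) → ZFSet.{u}) : Prop :=
  (∀ v, (∀ i, v i ∈ M) → T v ∈ M) ∧
    Dfn M (fun w : Fin (n + 1) → ZFSet.{u} => w 0 = T fun i => w i.succ)

section Dfn

variable {M : Set ZFSet.{u}} {n m : ℕ} {P Q : (Fin n → ZFSet.{u}) → Prop}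
  {T S : (Fin n → ZFSet.{u}) → ZFSet.{u}}

theorem Dfn.congr (h : Dfn M P) (hPQ : ∀ v, (∀ i, v i ∈ M) → (P v ↔ Q v)) : Dfn M Q := by
  unfold Dfn at *
  convert! h using 1
  ext v
  exact (hPQ _ fun i => (v i).2).symm

theorem Dfn.and (hP : Dfn M P) (hQ : Dfn M Q) : Dfn M fun v => P v ∧ Q v :=
  Set.Definable.inter hP hQ

theorem Dfn.or (hP : Dfn M P) (hQ : Dfn M Q) : Dfn M fun v => P v ∨ Q v :=
  Set.Definable.union hP hQ

theorem Dfn.not (hP : Dfn M P) : Dfn M fun v => ¬ P v :=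
  Set.Definable.compl hP

theorem Dfn.imp (hP : Dfn M P) (hQ : Dfn M Q) : Dfn M fun v => P v → Q v :=
  (hP.not.or hQ).congr fun _ _ => imp_iff_not_or.symm

theorem Dfn.iff (hP : Dfn M P) (hQ : Dfn M Q) : Dfn M fun v => P v ↔ Q v :=
  ((hP.imp hQ).and (hQ.imp hP)).congr fun _ _ => iff_def.symm

theorem Dfn.rename (hP : Dfn M P) (f : Fin n → Fin m) : Dfn M fun v => P fun i => v (f i) :=
  Set.Definable.preimage_comp f hP

theorem Dfn.ex {P : ZFSet.{u} → (Fin n → ZFSet.{u}) → Prop}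
    (hP : Dfn M fun w : Fin (n + 1) → ZFSet.{u} => P (w 0) fun i => w i.succ) :
    Dfn M fun v => ∃ z ∈ M, P z v := by
  have h := Set.Definable.exists_of_finite (α := Fin n) (β := Fin 1)
    (Set.Definable.preimage_comp
      (Fin.cons (Sum.inr 0) Sum.inl : Fin (n + 1) → Fin n ⊕ Fin 1) hP)
  unfold Dfn
  convert! h using 1
  ext v
  simp only [Set.mem_ofPred_eq, Set.mem_preimage, Function.comp_apply, Fin.cons_zero,
    Fin.cons_succ, Sum.elim_inl, Sum.elim_inr]
  constructor
  · rintro ⟨z, hz, h⟩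
    exact ⟨fun _ => ⟨z, hz⟩, h⟩
  · rintro ⟨z, h⟩
    exact ⟨_, (z 0).2, h⟩

theorem Dfn.all {P : ZFSet.{u} → (Fin n → ZFSet.{u}) → Prop}
    (hP : Dfn M fun w : Fin (n + 1) → ZFSet.{u} => P (w 0) fun i => w i.succ) :
    Dfn M fun v => ∀ z ∈ M, P z v :=
  (Dfn.ex (P := fun z v => ¬ P z v) hP.not).not.congr fun v _ => by push Not; rfl

theorem Dfn.mem_var (i j : Fin n) : Dfn M fun v => v i ∈ v j :=
  ⟨FirstOrder.Language.Relations.formula (L := setLanguage.withConstants (Set.univ : Set M))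
      (Sum.inl MemRel.mem)
      ![FirstOrder.Language.Term.var i, FirstOrder.Language.Term.var j], by
    ext v
    simp only [Set.mem_ofPred_eq]
    rfl⟩

theorem Dfn.eq_var (i j : Fin n) : Dfn M fun v => v i = v j :=
  ⟨(FirstOrder.Language.Term.var i).equal (FirstOrder.Language.Term.var j), by
    ext v
    simp [Subtype.ext_iff]⟩

theorem Trm.var (i : Fin n) : Trm M fun v : Fin n → ZFSet.{u} => v i :=
  ⟨fun _ hv => hv i, Dfn.eq_var 0 i.succ⟩

theorem Trm.const {c : ZFSet.{u}} (hc : c ∈ M) : Trm M fun _ : Fin n → ZFSet.{u} => c := by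
  refine ⟨fun _ _ => hc, ?_⟩
  have h := Set.Definable.preimage_comp (fun _ : Fin 1 => (0 : Fin (n + 1)))
    (Set.Definable.singleton_of_mem setLanguage (Set.mem_univ (⟨c, hc⟩ : M)))
  unfold Dfn
  convert! h using 1
  ext v
  simp [Subtype.ext_iff]

theorem Trm.rename (hT : Trm M T) (f : Fin n → Fin m) : Trm M fun v => T fun i => v (f i) :=
  ⟨fun _ hv => hT.1 _ fun i => hv (f i), by
    simpa using hT.2.rename (Fin.cons 0 (Fin.succ ∘ f) : Fin (n + 1) → Fin (m + 1))⟩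

/-- The value of the term is named by a quantifier over M, which is harmless because M is closed
under the operation. -/
theorem Dfn.subst {P : ZFSet.{u} → (Fin n → ZFSet.{u}) → Prop} (hT : Trm M T)
    (hP : Dfn M fun w : Fin (n + 1) → ZFSet.{u} => P (w 0) fun i => w i.succ) :
    Dfn M fun v => P (T v) v :=
  (Dfn.ex (P := fun z v => z = T v ∧ P z v) (hT.2.and hP)).congr fun v hv =>
    ⟨fun ⟨_, _, e, h⟩ => e ▸ h, fun h => ⟨_, hT.1 v hv, rfl, h⟩⟩

theorem Dfn.mem (hT : Trm M T) (hS : Trm M S) : Dfn M fun v => T v ∈ S v :=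
  Dfn.subst (P := fun z v => z ∈ S v) hT
    (Dfn.subst (T := fun w => S fun i => w i.succ) (P := fun y w => w 0 ∈ y)
      (hS.rename Fin.succ) (Dfn.mem_var 1 0))

theorem Dfn.eq (hT : Trm M T) (hS : Trm M S) : Dfn M fun v => T v = S v :=
  Dfn.subst (P := fun z v => z = S v) hT
    (Dfn.subst (T := fun w => S fun i => w i.succ) (P := fun y w => w 0 = y)
      (hS.rename Fin.succ) (Dfn.eq_var 1 0))

end Dfn

/-! ### Closure of a transitive model under basic operations -/

section Model

variable {M : Set ZFSet.{u}} {n : ℕ} {T S : (Fin n → ZFSet.{u}) → ZFSet.{u}}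

/-- Transitivity makes bounded quantifiers absolute: all elements of a member of M are in M. -/
theorem Dfn.bex (hM : IsTransitiveModel M) {P : ZFSet.{u} → (Fin n → ZFSet.{u}) → Prop}
    (hT : Trm M T) (hP : Dfn M fun w : Fin (n + 1) → ZFSet.{u} => P (w 0) fun i => w i.succ) :
    Dfn M fun v => ∃ z ∈ T v, P z v :=
  (Dfn.ex (P := fun z v => z ∈ T v ∧ P z v)
    ((Dfn.mem (Trm.var 0) (hT.rename Fin.succ)).and hP)).congr fun v hv =>
    ⟨fun ⟨z, _, h⟩ => ⟨z, h⟩, fun ⟨z, h⟩ => ⟨z, hM.transitive _ (hT.1 v hv) _ h.1, h⟩⟩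

theorem Dfn.ball (hM : IsTransitiveModel M) {P : ZFSet.{u} → (Fin n → ZFSet.{u}) → Prop}
    (hT : Trm M T) (hP : Dfn M fun w : Fin (n + 1) → ZFSet.{u} => P (w 0) fun i => w i.succ) :
    Dfn M fun v => ∀ z ∈ T v, P z v :=
  (Dfn.bex hM (P := fun z v => ¬ P z v) hT hP.not).not.congr fun v _ => by push Not; rfl

namespace IsTransitiveModel

theorem sep_mem (hM : IsTransitiveModel M) {P : ZFSet.{u} → Prop}
    (hP : Dfn M fun v : Fin 1 → ZFSet.{u} => P (v 0)) {x : ZFSet.{u}} (hx : x ∈ M) :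
    ZFSet.sep P x ∈ M := by
  obtain ⟨⟨y, hy⟩, h⟩ := hM.models.separation {z : M | P z.1} hP ⟨x, hx⟩
  convert! hy using 1
  ext z
  rw [ZFSet.mem_sep]
  constructor
  · intro hz
    exact (h ⟨z, hM.transitive _ hx _ hz.1⟩).2 hz
  · intro hz
    exact (h ⟨z, hM.transitive _ hy _ hz⟩).1 hz

theorem pair_set_mem (hM : IsTransitiveModel M) {x y : ZFSet.{u}} (hx : x ∈ M) (hy : y ∈ M) :
    ({x, y} : ZFSet.{u}) ∈ M := by
  obtain ⟨⟨p, hp⟩, h⟩ := hM.models.pairing ⟨x, hx⟩ ⟨y, hy⟩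
  convert! hp using 1
  ext z
  rw [ZFSet.mem_pair]
  constructor
  · rintro (rfl | rfl)
    · exact (h ⟨_, hx⟩).2 (Or.inl rfl)
    · exact (h ⟨_, hy⟩).2 (Or.inr rfl)
  · intro hz
    exact ((h ⟨z, hM.transitive _ hp _ hz⟩).1 hz).imp (congrArg Subtype.val) (congrArg Subtype.val)

theorem singleton_mem (hM : IsTransitiveModel M) {x : ZFSet.{u}} (hx : x ∈ M) :
    ({x} : ZFSet.{u}) ∈ M := by
  have h := hM.pair_set_mem hx hx
  rwa [show ({x, x} : ZFSet.{u}) = {x} by ext z; simp] at h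

theorem pair_mem (hM : IsTransitiveModel M) {x y : ZFSet.{u}} (hx : x ∈ M) (hy : y ∈ M) :
    ZFSet.pair x y ∈ M :=
  hM.pair_set_mem (hM.singleton_mem hx) (hM.pair_set_mem hx hy)

theorem mem_of_pair_mem (hM : IsTransitiveModel M) {x y : ZFSet.{u}} (h : ZFSet.pair x y ∈ M) :
    x ∈ M ∧ y ∈ M := by
  have h' : ({x, y} : ZFSet.{u}) ∈ M := hM.transitive _ h _ (by simp [ZFSet.pair])
  exact ⟨hM.transitive _ h' _ (by simp), hM.transitive _ h' _ (by simp)⟩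

theorem sUnion_mem (hM : IsTransitiveModel M) {x : ZFSet.{u}} (hx : x ∈ M) :
    (ZFSet.sUnion x) ∈ M := by
  obtain ⟨⟨s, hs⟩, h⟩ := hM.models.union ⟨x, hx⟩
  convert! hs using 1
  ext z
  rw [ZFSet.mem_sUnion]
  constructor
  · rintro ⟨y, hy, hz⟩
    have hy' := hM.transitive _ hx _ hy
    exact (h ⟨z, hM.transitive _ hy' _ hz⟩).2 ⟨⟨y, hy'⟩, hy, hz⟩
  · intro hz
    obtain ⟨y, hy, hz⟩ := (h ⟨z, hM.transitive _ hs _ hz⟩).1 hz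
    exact ⟨y, hy, hz⟩

theorem union_mem (hM : IsTransitiveModel M) {x y : ZFSet.{u}} (hx : x ∈ M) (hy : y ∈ M) :
    x ∪ y ∈ M :=
  hM.sUnion_mem (hM.pair_set_mem hx hy)

theorem insert_mem (hM : IsTransitiveModel M) {x y : ZFSet.{u}} (hx : x ∈ M) (hy : y ∈ M) :
    insert x y ∈ M := by
  rw [ZFSet.insert_eq]
  exact hM.union_mem (hM.singleton_mem hx) hy

theorem empty_mem (hM : IsTransitiveModel M) : (∅ : ZFSet.{u}) ∈ M := by
  obtain ⟨_, ⟨⟨e, he⟩, -, h⟩, -⟩ := hM.models.infinity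
  rwa [← (ZFSet.eq_empty e).2 fun z hz => h ⟨z, hM.transitive _ he _ hz⟩ hz]

theorem numeral_mem (hM : IsTransitiveModel M) (n : ℕ) : numeral n ∈ M := by
  induction n with
  | zero => exact hM.empty_mem
  | succ n ih => exact hM.insert_mem ih ih

theorem exists_powerset (hM : IsTransitiveModel M) {x : ZFSet.{u}} (hx : x ∈ M) :
    ∃ p ∈ M, ∀ y, y ∈ p ↔ y ∈ M ∧ y ⊆ x := by
  obtain ⟨⟨p, hp⟩, h⟩ := hM.models.powerset ⟨x, hx⟩
  refine ⟨p, hp, fun y => ⟨fun hy => ?_, fun hy => ?_⟩⟩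
  · have hyM := hM.transitive _ hp _ hy
    exact ⟨hyM, fun z hz => (h ⟨y, hyM⟩).1 hy ⟨z, hM.transitive _ hyM _ hz⟩ hz⟩
  · exact (h ⟨y, hy.1⟩).2 fun z hz => hy.2 hz

theorem exists_coe_eq (hM : IsTransitiveModel M) {s : Set ZFSet.{u}} (hs : s.Finite)
    (h : s ⊆ M) : ∃ y ∈ M, (y : Set ZFSet.{u}) = s := by
  induction s, hs using Set.Finite.induction_on with
  | empty => exact ⟨∅, hM.empty_mem, by ext; simp⟩
  | @insert a s _ _ ih =>
    obtain ⟨y, hy, rfl⟩ := ih fun z hz => h (Set.mem_insert_of_mem _ hz)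
    exact ⟨insert a y, hM.insert_mem (h (Set.mem_insert _ _)) hy, by ext; simp⟩

theorem mem_of_finite (hM : IsTransitiveModel M) {x : ZFSet.{u}} (hx : (x : Set ZFSet.{u}).Finite)
    (h : ∀ y ∈ x, y ∈ M) : x ∈ M := by
  obtain ⟨y, hy, e⟩ := hM.exists_coe_eq hx h
  rwa [← SetLike.coe_injective e]

end IsTransitiveModel

theorem Trm.insert (hM : IsTransitiveModel M) (hT : Trm M T) (hS : Trm M S) :
    Trm M fun v => insert (T v) (S v) := by
  refine ⟨fun v hv => hM.insert_mem (hT.1 v hv) (hS.1 v hv), ?_⟩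
  refine Dfn.congr (P := fun w => ∀ z ∈ M, z ∈ w 0 ↔
    z = (T fun i => w i.succ) ∨ z ∈ S fun i => w i.succ) ?_ fun v hv => ?_
  · refine Dfn.all (Dfn.iff (Dfn.mem (Trm.var 0) (Trm.var 1)) (Dfn.or (Dfn.eq (Trm.var 0) ?_)
      (Dfn.mem (Trm.var 0) ?_)))
    · exact hT.rename fun i => i.succ.succ
    · exact hS.rename fun i => i.succ.succ
  · have h1 := hT.1 _ fun i => hv (Fin.succ i)
    have h2 := hS.1 _ fun i => hv (Fin.succ i)
    constructor
    · intro h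
      ext z
      rw [ZFSet.mem_insert_iff]
      refine ⟨fun hz => (h z (hM.transitive _ (hv 0) _ hz)).1 hz, fun hz => ?_⟩
      refine (h z ?_).2 hz
      rcases hz with rfl | hz
      exacts [h1, hM.transitive _ h2 _ hz]
    · intro h z _
      rw [h, ZFSet.mem_insert_iff]

theorem Trm.singleton (hM : IsTransitiveModel M) (hT : Trm M T) :
    Trm M fun v => ({T v} : ZFSet.{u}) := by
  have h := Trm.insert hM hT (Trm.const hM.empty_mem)
  convert! h using 2

theorem Trm.pair (hM : IsTransitiveModel M) (hT : Trm M T) (hS : Trm M S) :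
    Trm M fun v => ZFSet.pair (T v) (S v) :=
  Trm.insert hM (hT.singleton hM) ((hT.insert hM (hS.singleton hM)).singleton hM)

end Model

/-! ### Numerals -/

theorem mem_numeral {x : ZFSet.{u}} {n : ℕ} : x ∈ numeral n ↔ ∃ m < n, x = numeral m := by
  induction n with
  | zero => simp [numeral]
  | succ n ih =>
    rw [numeral, ZFSet.mem_insert_iff, ih]
    constructor
    · rintro (rfl | ⟨m, hm, rfl⟩)
      exacts [⟨n, n.lt_succ_self, rfl⟩, ⟨m, hm.trans n.lt_succ_self, rfl⟩]
    · rintro ⟨m, hm, rfl⟩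
      rcases Nat.lt_succ_iff_lt_or_eq.1 hm with h | rfl
      exacts [Or.inr ⟨m, h, rfl⟩, Or.inl rfl]

theorem numeral_injective : Function.Injective numeral.{u} := by
  intro m n h
  by_contra hne
  rcases lt_or_gt_of_ne hne with h' | h'
  · exact ZFSet.mem_irrefl (numeral n) (mem_numeral.2 ⟨m, h', h.symm⟩)
  · exact ZFSet.mem_irrefl (numeral m) (mem_numeral.2 ⟨n, h', h⟩)

theorem numeral_mem_numeral {m n : ℕ} : numeral.{u} m ∈ numeral n ↔ m < n := by
  rw [mem_numeral]
  exact ⟨fun ⟨_, hk, e⟩ => numeral_injective e ▸ hk, fun h => ⟨m, h, rfl⟩⟩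

theorem mem_omega_iff {x : ZFSet.{u}} : x ∈ ZFSet.omega ↔ ∃ n, x = numeral n := by
  have key : ∀ n, numeral.{u} n = ZFSet.mk (PSet.ofNat n) := by
    intro n
    induction n with
    | zero => rfl
    | succ n ih => rw [numeral, ih]; rfl
  constructor
  · refine Quotient.inductionOn x fun x hx => ?_
    obtain ⟨⟨n⟩, hn⟩ := hx
    exact ⟨n, (ZFSet.sound hn).trans (key n).symm⟩
  · rintro ⟨n, rfl⟩
    induction n with
    | zero => exact ZFSet.omega_zero
    | succ n ih => exact ZFSet.omega_succ ih

theorem numeral_mem_omega (n : ℕ) : numeral.{u} n ∈ ZFSet.omega :=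
  mem_omega_iff.2 ⟨n, rfl⟩

theorem mem_two {i : ZFSet.{u}} :
    i ∈ ({numeral 0, numeral 1} : ZFSet.{u}) ↔ i = numeral 0 ∨ i = numeral 1 :=
  ZFSet.mem_pair

/-! ### The set ω and products inside a transitive model -/

section Model

variable {M : Set ZFSet.{u}} {n : ℕ} {T S : (Fin n → ZFSet.{u}) → ZFSet.{u}}

theorem Dfn.subst₂ {R : ZFSet.{u} → ZFSet.{u} → Prop}
    (hR : Dfn M fun v : Fin 2 → ZFSet.{u} => R (v 0) (v 1)) (hT : Trm M T) (hS : Trm M S) :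
    Dfn M fun v => R (T v) (S v) :=
  Dfn.subst (P := fun z v => R z (S v)) hT
    (Dfn.subst (T := fun w => S fun i => w i.succ) (P := fun y w => R (w 0) y)
      (hS.rename Fin.succ) (hR.rename ![1, 0]))

namespace IsTransitiveModel

theorem omega_mem (hM : IsTransitiveModel M) : ZFSet.omega ∈ M := by
  obtain ⟨⟨I, hI⟩, ⟨⟨e, he⟩, heI, h0⟩, h1⟩ := hM.models.infinity
  have h0 : ∅ ∈ I := by
    rwa [← (ZFSet.eq_empty e).2 fun z hz => h0 ⟨z, hM.transitive _ he _ hz⟩ hz]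
  have h1 : ∀ y ∈ I, insert y y ∈ I := by
    intro y hy
    have hyM := hM.transitive _ hI _ hy
    obtain ⟨⟨s, hs⟩, hsI, h⟩ := h1 ⟨y, hyM⟩ hy
    convert! hsI using 1
    ext z
    rw [ZFSet.mem_insert_iff, or_comm]
    constructor
    · intro hz
      refine (h ⟨z, ?_⟩).2 (hz.imp id Subtype.ext)
      rcases hz with hz | rfl
      exacts [hM.transitive _ hyM _ hz, hyM]
    · intro hz
      exact ((h ⟨z, hM.transitive _ hs _ hz⟩).1 hz).imp id (congrArg Subtype.val)
  -- The least inductive set in the sense of M, to be identified with the true ω.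
  set N := ZFSet.sep (fun k => ∀ J ∈ M, ∅ ∈ J → (∀ y ∈ J, insert y y ∈ J) → k ∈ J) I with hN
  have hNM : N ∈ M := by
    have := hM.empty_mem
    refine hM.sep_mem ?_ hI
    apply_rules [Dfn.all, Dfn.imp, Dfn.ball, Dfn.mem, Trm.const, Trm.var, Trm.insert]
  have hN0 : ∅ ∈ N := ZFSet.mem_sep.2 ⟨h0, fun _ _ h _ => h⟩
  have hN1 : ∀ y ∈ N, insert y y ∈ N := fun y hy => ZFSet.mem_sep.2
    ⟨h1 y (ZFSet.mem_sep.1 hy).1, fun J hJ hJ0 hJ1 => hJ1 y ((ZFSet.mem_sep.1 hy).2 J hJ hJ0 hJ1)⟩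
  -- An ∈-minimal z ∈ N that is not a numeral could be removed: N \ {z} would still be inductive, as
  -- z is neither ∅ nor the successor of a numeral.
  have hNω : ∀ z, z ∈ N → ∃ k, z = numeral k := by
    intro z
    induction z using ZFSet.inductionOn with
    | _ z ih =>
    intro hz
    by_contra hcon
    have hJ : ZFSet.sep (fun y => y ≠ z) N ∈ M := by
      have := hM.transitive _ hNM _ hz
      refine hM.sep_mem ?_ hNM
      apply_rules [Dfn.not, Dfn.eq, Trm.const, Trm.var]
    refine (ZFSet.mem_sep.1 ((ZFSet.mem_sep.1 hz).2 _ hJ (ZFSet.mem_sep.2 ⟨hN0, ?_⟩) ?_)).2 rfl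
    · rintro rfl
      exact hcon ⟨0, rfl⟩
    · intro y hy
      have hyN := (ZFSet.mem_sep.1 hy).1
      refine ZFSet.mem_sep.2 ⟨hN1 y hyN, ?_⟩
      rintro rfl
      obtain ⟨k, hk⟩ := ih y (ZFSet.mem_insert _ _) hyN
      exact hcon ⟨k + 1, by rw [hk]; rfl⟩
  convert! hNM using 1
  ext z
  refine ⟨fun hz => ?_, fun hz => mem_omega_iff.2 (hNω z hz)⟩
  obtain ⟨k, rfl⟩ := mem_omega_iff.1 hz
  clear hz
  induction k with
  | zero => exact hN0
  | succ k ih => exact hN1 _ ih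

theorem prod_mem (hM : IsTransitiveModel M) {x y : ZFSet.{u}} (hx : x ∈ M) (hy : y ∈ M) :
    ZFSet.prod x y ∈ M := by
  obtain ⟨p, hp, hpm⟩ := hM.exists_powerset (hM.union_mem hx hy)
  obtain ⟨q, hq, hqm⟩ := hM.exists_powerset hp
  have h : ZFSet.sep (fun z => ∃ a ∈ x, ∃ b ∈ y, z = ZFSet.pair a b) q ∈ M := by
    refine hM.sep_mem ?_ hq
    apply_rules [Dfn.bex, Dfn.eq, Trm.const, Trm.var, Trm.pair]
  convert! h using 1
  ext z
  rw [ZFSet.mem_prod, ZFSet.mem_sep, iff_and_self]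
  rintro ⟨a, ha, b, hb, rfl⟩
  have haM := hM.transitive _ hx _ ha
  have hbM := hM.transitive _ hy _ hb
  refine (hqm _).2 ⟨hM.pair_mem haM hbM, fun w hw => (hpm _).2 ?_⟩
  rcases ZFSet.mem_pair.1 hw with rfl | rfl
  · refine ⟨hM.singleton_mem haM, fun t ht => ?_⟩
    rw [ZFSet.mem_singleton.1 ht]
    exact ZFSet.mem_union.2 (Or.inl ha)
  · refine ⟨hM.pair_set_mem haM hbM, fun t ht => ?_⟩
    rcases ZFSet.mem_pair.1 ht with rfl | rfl
    exacts [ZFSet.mem_union.2 (Or.inl ha), ZFSet.mem_union.2 (Or.inr hb)]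

theorem two_mem (hM : IsTransitiveModel M) : ({numeral 0, numeral 1} : ZFSet.{u}) ∈ M :=
  hM.pair_set_mem (hM.numeral_mem 0) (hM.numeral_mem 1)

end IsTransitiveModel

/-! ### Finiteness inside a transitive model -/

/-- Some relation in `M` injects `s` into `k`. -/
def CardLe (M : Set ZFSet.{u}) (s k : ZFSet.{u}) : Prop :=
  ∃ φ ∈ M, (∀ t ∈ s, ∃ j ∈ k, ZFSet.pair t j ∈ φ) ∧
    ∀ t ∈ s, ∀ t' ∈ s, ∀ j ∈ k, ZFSet.pair t j ∈ φ → ZFSet.pair t' j ∈ φ → t = t'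

theorem Dfn.cardLe (hM : IsTransitiveModel M) (hT : Trm M T) (hS : Trm M S) :
    Dfn M fun v => CardLe M (T v) (S v) := by
  refine Dfn.subst₂ ?_ hT hS
  unfold CardLe
  apply_rules [Dfn.ex, Dfn.and, Dfn.imp, Dfn.bex, Dfn.ball, Dfn.mem, Dfn.eq, Trm.var, Trm.pair]

/-- Finiteness is absolute because an injection of a finite subset of M into a numeral is a finite
set of pairs, hence an element of M. This lets conditions of the Cohen poset be described by a
formula. -/
theorem cardLe_numeral (hM : IsTransitiveModel M) {s : ZFSet.{u}} (hs : s ∈ M) {k : ℕ} :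
    CardLe M s (numeral k) ↔
      (s : Set ZFSet.{u}).Finite ∧ (s : Set ZFSet.{u}).ncard ≤ k := by
  constructor
  · rintro ⟨φ, -, h1, h2⟩
    have h1 : ∀ t ∈ s, ∃ j < k, ZFSet.pair t (numeral j) ∈ φ := by
      intro t ht
      obtain ⟨_, hj, h⟩ := h1 t ht
      obtain ⟨j, hjk, rfl⟩ := mem_numeral.1 hj
      exact ⟨j, hjk, h⟩
    choose! g hg hgφ using h1
    have hmaps : Set.MapsTo g (s : Set ZFSet.{u}) (Set.Iio k) := fun t ht => hg t ht
    have hinj : Set.InjOn g (s : Set ZFSet.{u}) := fun t ht t' ht' e =>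
      h2 t ht t' ht' _ (numeral_mem_numeral.2 (hg t ht)) (hgφ t ht) (e ▸ hgφ t' ht')
    refine ⟨Set.Finite.of_injOn hmaps hinj (Set.finite_Iio k), ?_⟩
    have h := Set.ncard_le_ncard_of_injOn g hmaps hinj (Set.finite_Iio k)
    simpa using h
  · rintro ⟨hfin, hcard⟩
    obtain ⟨g, hg⟩ : ∃ g : ↥(s : Set ZFSet.{u}) → Fin k, Function.Injective g := by
      have := hfin.fintype
      obtain ⟨g⟩ := Function.Embedding.nonempty_of_card_le (α := (s : Set ZFSet.{u}))
        (β := Fin k) (by rwa [Fintype.card_fin, ← Nat.card_eq_fintype_card])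
      exact ⟨g, g.injective⟩
    have := hfin.to_subtype
    obtain ⟨φ, hφ, e⟩ := hM.exists_coe_eq
      (Set.finite_range fun t : ↥(s : Set ZFSet.{u}) => ZFSet.pair t.1 (numeral (g t).1)) (by
        rintro _ ⟨t, rfl⟩
        exact hM.pair_mem (hM.transitive _ hs _ t.2) (hM.numeral_mem _))
    have hmem : ∀ t j, ZFSet.pair t j ∈ φ ↔ ∃ h : t ∈ s, j = numeral (g ⟨t, h⟩).1 := by
      intro t j
      rw [← SetLike.mem_coe, e]
      constructor
      · rintro ⟨t', h⟩
        obtain ⟨rfl, rfl⟩ := ZFSet.pair_inj.1 h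
        exact ⟨t'.2, rfl⟩
      · rintro ⟨h, rfl⟩
        exact ⟨⟨t, h⟩, rfl⟩
    refine ⟨φ, hφ, fun t ht => ⟨_, numeral_mem_numeral.2 (g ⟨t, ht⟩).2, (hmem _ _).2 ⟨ht, rfl⟩⟩, ?_⟩
    intro t ht t' ht' j _ h h'
    obtain ⟨_, rfl⟩ := (hmem _ _).1 h
    obtain ⟨_, h'⟩ := (hmem _ _).1 h'
    exact congrArg Subtype.val (hg (Fin.ext (numeral_injective h')))

theorem finite_iff_cardLe (hM : IsTransitiveModel M) {s : ZFSet.{u}} (hs : s ∈ M) :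
    (s : Set ZFSet.{u}).Finite ↔ ∃ k ∈ ZFSet.omega, CardLe M s k := by
  constructor
  · intro h
    exact ⟨_, numeral_mem_omega _, (cardLe_numeral hM hs).2 ⟨h, le_rfl⟩⟩
  · rintro ⟨_, hk, h⟩
    obtain ⟨k, rfl⟩ := mem_omega_iff.1 hk
    exact ((cardLe_numeral hM hs).1 h).1

/-! ### The Cohen poset -/

theorem IsCohen.exists_of_mem {X h p : ZFSet.{u}} (hh : IsCohen X h) (hp : p ∈ h) :
    ∃ a ∈ X, ∃ i, (i = numeral 0 ∨ i = numeral 1) ∧ p = ZFSet.pair a i := by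
  obtain ⟨a, ha, i, hi, rfl⟩ := ZFSet.mem_prod.1 (hh.1 hp)
  exact ⟨a, ha, i, mem_two.1 hi, rfl⟩

theorem IsCohen.mem_of_pair_mem {X h a i : ZFSet.{u}} (hh : IsCohen X h)
    (hp : ZFSet.pair a i ∈ h) : a ∈ X ∧ (i = numeral 0 ∨ i = numeral 1) := by
  have := ZFSet.pair_mem_prod.1 (hh.1 hp)
  exact ⟨this.1, mem_two.1 this.2⟩

theorem IsCohen.mem (hM : IsTransitiveModel M) {X h : ZFSet.{u}} (hX : X ∈ M)
    (hh : IsCohen X h) : h ∈ M :=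
  hM.mem_of_finite hh.2.1 fun _ hp => hM.transitive _ (hM.prod_mem hX hM.two_mem) _ (hh.1 hp)

/-- The Cohen poset of a set in `M` belongs to `M`. -/
theorem IsTransitiveModel.exists_cohen (hM : IsTransitiveModel M) {X : ZFSet.{u}} (hX : X ∈ M) :
    ∃ p ∈ M, ∀ h, h ∈ p ↔ IsCohen X h := by
  have h2 := hM.two_mem
  have hω := hM.omega_mem
  obtain ⟨p, hp, hpm⟩ := hM.exists_powerset (hM.prod_mem hX h2)
  refine ⟨_, hM.sep_mem (P := fun h => (∃ k ∈ ZFSet.omega, CardLe M h k) ∧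
    ∀ x ∈ X, ∀ i ∈ ({numeral 0, numeral 1} : ZFSet.{u}), ∀ j ∈ ({numeral 0, numeral 1} : ZFSet.{u}),
      ZFSet.pair x i ∈ h → ZFSet.pair x j ∈ h → i = j) ?_ hp, fun h => ?_⟩
  · apply_rules [Dfn.and, Dfn.imp, Dfn.bex, Dfn.ball, Dfn.mem, Dfn.eq, Dfn.cardLe, Trm.var,
      Trm.pair, Trm.const]
  · rw [ZFSet.mem_sep, hpm]
    constructor
    · rintro ⟨⟨hhM, hsub⟩, hfin, hfun⟩
      refine ⟨hsub, (finite_iff_cardLe hM hhM).2 hfin, fun x i j hi hj => ?_⟩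
      have h1 := ZFSet.pair_mem_prod.1 (hsub hi)
      have h2 := ZFSet.pair_mem_prod.1 (hsub hj)
      exact hfun x h1.1 i h1.2 j h2.2 hi hj
    · intro hh
      have hhM := hh.mem hM hX
      exact ⟨⟨hhM, hh.1⟩, (finite_iff_cardLe hM hhM).1 hh.2.1, fun x _ i _ j _ => hh.2.2 x i j⟩

theorem IsTransitiveModel.sep_cohen_mem (hM : IsTransitiveModel M) {X : ZFSet.{u}} (hX : X ∈ M)
    {P : ZFSet.{u} → Prop} (hP : Dfn M fun v : Fin 1 → ZFSet.{u} => P (v 0)) :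
    ∃ D ∈ M, ∀ h, h ∈ D ↔ IsCohen X h ∧ P h := by
  obtain ⟨p, hp, hpm⟩ := hM.exists_cohen hX
  exact ⟨_, hM.sep_mem hP hp, fun h => by rw [ZFSet.mem_sep, hpm]⟩

theorem IsCohen.union {X h g : ZFSet.{u}} (hh : IsCohen X h) (hg : IsCohen X g)
    (hc : ∀ x i j, ZFSet.pair x i ∈ h → ZFSet.pair x j ∈ g → i = j) : IsCohen X (h ∪ g) := by
  refine ⟨fun p hp => (ZFSet.mem_union.1 hp).elim (fun h' => hh.1 h') fun h' => hg.1 h',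
    (hh.2.1.union hg.2.1).subset fun p hp => ZFSet.mem_union.1 hp, fun x i j hi hj => ?_⟩
  rcases ZFSet.mem_union.1 hi with hi | hi <;> rcases ZFSet.mem_union.1 hj with hj | hj
  exacts [hh.2.2 x i j hi hj, hc x i j hi hj, (hc x j i hj hi).symm, hg.2.2 x i j hi hj]

end Model

section Model

variable {M : Set ZFSet.{u}}

/-! ### Choice inside a transitive model -/

/-- The axiom of choice speaks of disjoint families, so it is applied to the fibres {x} × {y ∈ Y | r
x y}, which differ in the first coordinate. -/
theorem IsTransitiveModel.exists_choice (hM : IsTransitiveModel M) {X Y : ZFSet.{u}} (hX : X ∈ M)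
    (hY : Y ∈ M) {r : ZFSet.{u} → ZFSet.{u} → Prop}
    (hr : Dfn M fun v : Fin 2 → ZFSet.{u} => r (v 0) (v 1)) (h : ∀ x ∈ X, ∃ y ∈ Y, r x y) :
    ∃ c ∈ M, ∀ x ∈ X, ∃! y, y ∈ Y ∧ r x y ∧ ZFSet.pair x y ∈ c := by
  have hXY := hM.prod_mem hX hY
  have hr' : ∀ {n : ℕ} {T S : (Fin n → ZFSet.{u}) → ZFSet.{u}}, Trm M T → Trm M S →
      Dfn M fun v => r (T v) (S v) := fun hT hS => Dfn.subst₂ hr hT hS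
  obtain ⟨q, hq, hqm⟩ := hM.exists_powerset hXY
  set F := ZFSet.sep (fun p => ∃ x ∈ X, ∀ z ∈ ZFSet.prod X Y,
    z ∈ p ↔ ∃ y ∈ Y, r x y ∧ z = ZFSet.pair x y) q with hF
  have hFM : F ∈ M := by
    refine hM.sep_mem ?_ hq
    apply_rules (maxDepth := 1000) [Dfn.and, Dfn.iff, Dfn.bex, Dfn.ball, Dfn.mem, Dfn.eq, Trm.var, Trm.pair, Trm.const]
  set G := fun x => ZFSet.sep (fun z => ∃ y ∈ Y, r x y ∧ z = ZFSet.pair x y) (ZFSet.prod X Y)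
    with hG
  have hGM : ∀ x ∈ X, G x ∈ M := by
    intro x hx
    have := hM.transitive _ hX _ hx
    refine hM.sep_mem ?_ hXY
    apply_rules (maxDepth := 1000) [Dfn.and, Dfn.bex, Dfn.eq, Trm.var, Trm.pair, Trm.const]
  have hmG : ∀ x ∈ X, ∀ z, z ∈ G x ↔ ∃ y ∈ Y, r x y ∧ z = ZFSet.pair x y := by
    intro x hx z
    rw [hG, ZFSet.mem_sep, and_iff_right_iff_imp]
    rintro ⟨y, hy, -, rfl⟩
    exact ZFSet.pair_mem_prod.2 ⟨hx, hy⟩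
  have hmF : ∀ p, p ∈ F ↔ ∃ x ∈ X, p = G x := by
    intro p
    rw [hF, ZFSet.mem_sep, hqm]
    constructor
    · rintro ⟨⟨-, hp⟩, x, hx, h⟩
      refine ⟨x, hx, ?_⟩
      ext z
      rw [hG, ZFSet.mem_sep]
      exact ⟨fun hz => ⟨hp hz, (h z (hp hz)).1 hz⟩, fun hz => (h z hz.1).2 hz.2⟩
    · rintro ⟨x, hx, rfl⟩
      exact ⟨⟨hGM x hx, ZFSet.sep_subset⟩, x, hx, fun z _ => hmG x hx z⟩
  obtain ⟨⟨c, hc⟩, hcF⟩ := hM.models.choice ⟨F, hFM⟩ (by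
      rintro ⟨p, hpM⟩ hp
      obtain ⟨x, hx, rfl⟩ := (hmF p).1 hp
      obtain ⟨y, hy, hxy⟩ := h x hx
      exact ⟨⟨_, hM.pair_mem (hM.transitive _ hX _ hx) (hM.transitive _ hY _ hy)⟩,
        (hmG x hx _).2 ⟨y, hy, hxy, rfl⟩⟩) (by
      rintro ⟨p, hpM⟩ ⟨p', hpM'⟩ hp hp' ⟨⟨z, hzM⟩, hz, hz'⟩
      obtain ⟨x, hx, rfl⟩ := (hmF p).1 hp
      obtain ⟨x', hx', rfl⟩ := (hmF p').1 hp'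
      obtain ⟨y, -, -, rfl⟩ := (hmG x hx z).1 hz
      obtain ⟨y', -, -, e⟩ := (hmG x' hx' _).1 hz'
      obtain ⟨rfl, -⟩ := ZFSet.pair_inj.1 e
      rfl)
  refine ⟨c, hc, fun x hx => ?_⟩
  obtain ⟨⟨z, hzM⟩, ⟨hz, hzc⟩, huniq⟩ := hcF ⟨G x, hGM x hx⟩ ((hmF _).2 ⟨x, hx, rfl⟩)
  obtain ⟨y, hy, hxy, rfl⟩ := (hmG x hx z).1 hz
  refine ⟨y, ⟨hy, hxy, hzc⟩, ?_⟩
  rintro y' ⟨hy', hxy', hc'⟩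
  have := huniq ⟨ZFSet.pair x y', hM.transitive _ hc _ hc'⟩ ⟨(hmG x hx _).2 ⟨y', hy', hxy', rfl⟩, hc'⟩
  exact (ZFSet.pair_inj.1 (congrArg Subtype.val this)).2

/-! ### Countability inside a transitive model -/

/-- A set in `M` with a definable linear order all of whose initial segments are finite is
countable in `M`. -/
theorem countableIn_of_finite_segments (hM : IsTransitiveModel M) {b : ZFSet.{u}} (hb : b ∈ M)
    {r : ZFSet.{u} → ZFSet.{u} → Prop} (hr : Dfn M fun v : Fin 2 → ZFSet.{u} => r (v 0) (v 1))
    {L : Type*} [LinearOrder L] (key : ZFSet.{u} → L) (hinj : ∀ s ∈ b, ∀ t ∈ b, key s = key t → s = t)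
    (hkey : ∀ s ∈ b, ∀ t ∈ b, r s t ↔ key s < key t)
    (hfin : ∀ t ∈ b, {s | s ∈ b ∧ r s t}.Finite) : CountableIn M b := by
  have hr' : ∀ {n : ℕ} {T S : (Fin n → ZFSet.{u}) → ZFSet.{u}}, Trm M T → Trm M S →
      Dfn M fun v => r (T v) (S v) := fun hT hS => Dfn.subst₂ hr hT hS
  have hω := hM.omega_mem
  set N := fun t => {s | s ∈ b ∧ r s t}.ncard with hN
  -- The map sends t to its number of predecessors, expressed as the least k into which the set of
  -- predecessors injects. It is injective since it is strictly increasing.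
  set f := ZFSet.sep (fun p => ∃ t ∈ b, ∃ k ∈ ZFSet.omega, p = ZFSet.pair t k ∧
    ∃ s ∈ M, ((∀ x ∈ s, x ∈ b ∧ r x t) ∧ ∀ x ∈ b, r x t → x ∈ s) ∧
      CardLe M s k ∧ ∀ j ∈ k, ¬ CardLe M s j) (ZFSet.prod b ZFSet.omega) with hf
  have hfM : f ∈ M := by
    refine hM.sep_mem ?_ (hM.prod_mem hb hω)
    apply_rules (maxDepth := 1000) [Dfn.not, Dfn.and, Dfn.imp, Dfn.bex, Dfn.ball, Dfn.ex, Dfn.mem, Dfn.eq, Dfn.cardLe,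
      Trm.var, Trm.pair, Trm.const]
  have hmf : ∀ t k, ZFSet.pair t k ∈ f ↔ t ∈ b ∧ k = numeral (N t) := by
    intro t k
    rw [hf, ZFSet.mem_sep, ZFSet.pair_mem_prod]
    constructor
    · rintro ⟨⟨ht, -⟩, t', -, k', hk', e, s, hs, ⟨h1, h2⟩, h3, h4⟩
      obtain ⟨rfl, rfl⟩ := ZFSet.pair_inj.1 e
      obtain ⟨k, rfl⟩ := mem_omega_iff.1 hk'
      have hs' : (s : Set ZFSet.{u}) = {s | s ∈ b ∧ r s t} :=
        Set.ext fun x => ⟨fun hx => h1 x hx, fun hx => h2 x hx.1 hx.2⟩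
      have h3 := (cardLe_numeral hM hs).1 h3
      rw [hs'] at h3
      refine ⟨ht, congrArg numeral (le_antisymm ?_ h3.2)⟩
      by_contra! hlt
      exact h4 _ (numeral_mem_numeral.2 hlt) ((cardLe_numeral hM hs).2 (by rw [hs']; exact ⟨h3.1, le_rfl⟩))
    · rintro ⟨ht, rfl⟩
      refine ⟨⟨ht, numeral_mem_omega _⟩, t, ht, _, numeral_mem_omega _, rfl, ?_⟩
      obtain ⟨s, hs, e⟩ := hM.exists_coe_eq (hfin t ht) fun x hx => hM.transitive _ hb _ hx.1
      refine ⟨s, hs, ⟨fun x hx => ?_, fun x hx hxt => ?_⟩, ?_, ?_⟩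
      · have : x ∈ (s : Set ZFSet.{u}) := hx
        rwa [e] at this
      · rw [← SetLike.mem_coe, e]
        exact ⟨hx, hxt⟩
      · rw [cardLe_numeral hM hs, e]
        exact ⟨hfin t ht, le_rfl⟩
      · intro j hj
        obtain ⟨i, hi, rfl⟩ := mem_numeral.1 hj
        rw [cardLe_numeral hM hs, e]
        exact fun h => absurd h.2 (not_le.2 hi)
  have hlt : ∀ s ∈ b, ∀ t ∈ b, key s < key t → N s < N t := by
    intro s hs t ht hst
    refine Set.ncard_lt_ncard ⟨fun x hx => ⟨hx.1, ?_⟩, fun h => ?_⟩ (hfin t ht)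
    · exact (hkey x hx.1 t ht).2 (((hkey x hx.1 s hs).1 hx.2).trans hst)
    · exact lt_irrefl _ ((hkey s hs s hs).1 (h ⟨hs, (hkey s hs t ht).2 hst⟩).2)
  refine ⟨f, hfM, ⟨ZFSet.sep_subset, fun t ht => ⟨numeral (N t), (hmf _ _).2 ⟨ht, rfl⟩,
    fun k hk => ((hmf _ _).1 hk).2⟩⟩, fun s t k hs ht => ?_⟩
  obtain ⟨hsb, rfl⟩ := (hmf _ _).1 hs
  obtain ⟨htb, e⟩ := (hmf _ _).1 ht
  have e := numeral_injective e
  refine hinj s hsb t htb (le_antisymm ?_ ?_) <;> by_contra! hcon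
  · exact (hlt t htb s hsb hcon).ne e.symm
  · exact (hlt s hsb t htb hcon).ne e

theorem eq_of_natSet_eq {x y : ZFSet.{u}} (hx : x ⊆ ZFSet.omega) (hy : y ⊆ ZFSet.omega)
    (h : natSet x = natSet y) : x = y := by
  ext z
  constructor
  · intro hz
    obtain ⟨n, rfl⟩ := mem_omega_iff.1 (hx hz)
    exact h.subset hz
  · intro hz
    obtain ⟨n, rfl⟩ := mem_omega_iff.1 (hy hz)
    exact h.superset hz

theorem lex_natSet_lt_iff {x y : ZFSet.{u}} :
    (toLex (fun n => n ∈ natSet x) : Lex (ℕ → Prop)) < toLex (fun n => n ∈ natSet y) ↔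
      ∃ k ∈ ZFSet.omega, (∀ j ∈ k, j ∈ x ↔ j ∈ y) ∧ k ∉ x ∧ k ∈ y := by
  constructor
  · rintro ⟨k, h1, h2⟩
    refine ⟨_, numeral_mem_omega k, fun j hj => ?_, ?_⟩
    · obtain ⟨i, hi, rfl⟩ := mem_numeral.1 hj
      exact iff_of_eq (h1 i hi)
    · obtain ⟨-, h⟩ := lt_iff_le_not_ge.1 h2
      exact (Classical.not_imp.1 h).symm
  · rintro ⟨_, hk, h1, h2, h3⟩
    obtain ⟨k, rfl⟩ := mem_omega_iff.1 hk
    refine ⟨k, fun j hj => propext (h1 _ (numeral_mem_numeral.2 hj)), ?_⟩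
    exact lt_iff_le_not_ge.2 ⟨fun _ => h3, fun h => h2 (h h3)⟩

/-- In `M`, a set of reals that is the union of an increasing sequence of finite sets is
countable. -/
theorem countableIn_of_levels (hM : IsTransitiveModel M) {b R : ZFSet.{u}} (hb : b ∈ M)
    (hR : R ∈ M) (hbω : ∀ a ∈ b, a ⊆ ZFSet.omega) {lev : ℕ → Set ZFSet.{u}} (hmono : Monotone lev)
    (hfin : ∀ n, (lev n).Finite) (hmem : ∀ n, ∀ a ∈ b, ZFSet.pair (numeral n) a ∈ R ↔ a ∈ lev n)
    (hcov : ∀ a ∈ b, ∃ n, a ∈ lev n) : CountableIn M b := by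
  classical
  have hω := hM.omega_mem
  set rk : ZFSet.{u} → ℕ := fun a => sInf {n | a ∈ lev n} with hrk
  have hle : ∀ a ∈ b, ∀ n, a ∈ lev n ↔ rk a ≤ n := by
    intro a ha n
    exact ⟨fun h => Nat.sInf_le h, fun h => hmono h (Nat.sInf_mem (hcov a ha))⟩
  -- Compare the first levels, then break ties by the first difference as subsets of ω. The order is
  -- definable from R, and the predecessors of t all lie in the finite level `rk t`.
  set r : ZFSet.{u} → ZFSet.{u} → Prop := fun s t =>
    (∃ n ∈ ZFSet.omega, ZFSet.pair n s ∈ R ∧ ZFSet.pair n t ∉ R) ∨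
    ((∀ n ∈ ZFSet.omega, ZFSet.pair n s ∈ R ↔ ZFSet.pair n t ∈ R) ∧
      ∃ k ∈ ZFSet.omega, (∀ j ∈ k, j ∈ s ↔ j ∈ t) ∧ k ∉ s ∧ k ∈ t) with hr
  set key : ZFSet.{u} → ℕ ×ₗ Lex (ℕ → Prop) := fun a =>
    toLex (rk a, toLex fun n => n ∈ natSet a) with hk
  have hkey : ∀ s ∈ b, ∀ t ∈ b, r s t ↔ key s < key t := by
    intro s hs t ht
    rw [hk, Prod.Lex.toLex_lt_toLex, lex_natSet_lt_iff, hr]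
    refine or_congr ?_ (and_congr_left fun _ => ?_)
    · constructor
      · rintro ⟨_, hn, h1, h2⟩
        obtain ⟨n, rfl⟩ := mem_omega_iff.1 hn
        rw [hmem n s hs, hle s hs] at h1
        rw [hmem n t ht, hle t ht] at h2
        exact h1.trans_lt (not_le.1 h2)
      · intro h
        refine ⟨_, numeral_mem_omega (rk s), ?_, ?_⟩
        · rw [hmem _ s hs, hle s hs]
        · rw [hmem _ t ht, hle t ht]
          exact not_le.2 h
    · constructor
      · intro h
        have h : ∀ n, rk s ≤ n ↔ rk t ≤ n := fun n => by
          rw [← hle s hs, ← hle t ht, ← hmem n s hs, ← hmem n t ht]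
          exact h _ (numeral_mem_omega n)
        exact le_antisymm ((h _).2 le_rfl) ((h _).1 le_rfl)
      · intro h _ hn
        obtain ⟨n, rfl⟩ := mem_omega_iff.1 hn
        rw [hmem n s hs, hmem n t ht, hle s hs, hle t ht]
        exact iff_of_eq (congrArg (· ≤ n) h)
  refine countableIn_of_finite_segments hM hb (r := r) ?_ key ?_ hkey ?_
  · apply_rules (maxDepth := 1000) [Dfn.not, Dfn.and, Dfn.or, Dfn.iff, Dfn.imp, Dfn.bex, Dfn.ball, Dfn.mem,
      Trm.var, Trm.pair, Trm.const]
  · intro s hs t ht h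
    refine eq_of_natSet_eq (hbω s hs) (hbω t ht) ?_
    have h2 := congrArg (fun p => ofLex (ofLex p).2) h
    ext n
    exact iff_of_eq (congrFun h2 n)
  · intro t ht
    refine (hfin (rk t)).subset fun s hs => ?_
    rw [hle s hs.1]
    have h := (hkey s hs.1 t ht).1 hs.2
    rw [hk, Prod.Lex.toLex_lt_toLex] at h
    exact h.elim le_of_lt fun h => h.1.le

end Model

/-! ### Countable subposets in which a dense set stays dense -/

/-- The levels of the closure of the empty set under the domains of the values of `K`, a relation
between conditions of the Cohen poset of `A`. -/
inductive Level (A : ZFSet.{u}) (K : ZFSet.{u} → ZFSet.{u} → Prop) : ℕ → ZFSet.{u} → Prop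
  | step {m n : ℕ} {h g a i : ZFSet.{u}} (hmn : m < n) (hh : IsCohen A h)
      (hm : ∀ b j, ZFSet.pair b j ∈ h → Level A K m b) (hK : K h g) (ha : ZFSet.pair a i ∈ g) :
      Level A K n a

section Level

variable {A : ZFSet.{u}} {K : ZFSet.{u} → ZFSet.{u} → Prop}

theorem Level.mono {m n : ℕ} (hmn : m ≤ n) {a : ZFSet.{u}} (h : Level A K m a) :
    Level A K n a := by
  obtain ⟨hlt, hh, hm, hK, ha⟩ := h
  exact .step (hlt.trans_le hmn) hh hm hK ha

theorem finite_setOf_pair_mem {g : ZFSet.{u}} (hg : (g : Set ZFSet.{u}).Finite) :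
    {a | ∃ i, ZFSet.pair a i ∈ g}.Finite := by
  have hinj : Set.InjOn (fun q : ZFSet.{u} × ZFSet.{u} => ZFSet.pair q.1 q.2)
      ((fun q : ZFSet.{u} × ZFSet.{u} => ZFSet.pair q.1 q.2) ⁻¹' (g : Set ZFSet.{u})) :=
    fun p _ q _ h => Prod.ext (ZFSet.pair_inj.1 h).1 (ZFSet.pair_inj.1 h).2
  refine ((hg.preimage hinj).image Prod.fst).subset ?_
  rintro a ⟨i, hi⟩
  exact ⟨(a, i), hi, rfl⟩

theorem finite_setOf_isCohen {s : Set ZFSet.{u}} (hs : s.Finite) :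
    {h | IsCohen A h ∧ ∀ a i, ZFSet.pair a i ∈ h → a ∈ s}.Finite := by
  have hfin : (Set.image2 ZFSet.pair s {numeral 0, numeral 1}).Finite :=
    hs.image2 _ (Set.toFinite _)
  refine Set.Finite.subset (hfin.finite_subsets.preimage
    (f := fun h : ZFSet.{u} => (h : Set ZFSet.{u})) SetLike.coe_injective.injOn) ?_
  rintro h ⟨hh, hs⟩ p hp
  obtain ⟨a, -, i, hi, rfl⟩ := hh.exists_of_mem hp
  exact ⟨a, hs a i hp, i, hi, rfl⟩

/-- Only finitely many conditions have their domain in a given finite level, and each contributes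
the finite domain of at most one value of K. -/
theorem Level.finite (hK : ∀ h g g', IsCohen A h → K h g → K h g' → g = g')
    (hKA : ∀ h g, K h g → IsCohen A g) (n : ℕ) : {a | Level A K n a}.Finite := by
  induction n using Nat.strong_induction_on with
  | _ n ih =>
  refine Set.Finite.subset (Set.Finite.biUnion (Set.finite_Iio n) (t := fun m =>
    ⋃ h ∈ {h | IsCohen A h ∧ ∀ a i, ZFSet.pair a i ∈ h → a ∈ {a | Level A K m a}},
      {a | ∃ g i, K h g ∧ ZFSet.pair a i ∈ g}) fun m hm =>
    Set.Finite.biUnion (finite_setOf_isCohen (ih m hm)) fun h hh => ?_) ?_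
  · by_cases hg : ∃ g, K h g
    · obtain ⟨g, hg⟩ := hg
      refine (finite_setOf_pair_mem (hKA h g hg).2.1).subset ?_
      rintro a ⟨g', i, hg', hi⟩
      rw [hK h g g' hh.1 hg hg']
      exact ⟨i, hi⟩
    · refine Set.finite_empty.subset ?_
      rintro a ⟨g, _, h', -⟩
      exact hg ⟨g, h'⟩
  · rintro a ⟨hlt, hh, hm, hKg, ha⟩
    exact Set.mem_biUnion hlt (Set.mem_biUnion ⟨hh, hm⟩ ⟨_, _, hKg, ha⟩)

end Level

variable {M : Set ZFSet.{u}}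

/-- In `M`, for each dense subset `D` of the Cohen poset of a set of reals `A` there is a countable
`b ⊆ A` such that `D` is dense in the Cohen poset of `b`. -/
theorem exists_countable_dense (hM : IsTransitiveModel M) {A D : ZFSet.{u}} (hA : A ∈ M)
    (hAω : ∀ a ∈ A, a ⊆ ZFSet.omega) (hD : D ∈ M) (hDA : IsCohenDense A D) :
    ∃ b ∈ M, b ⊆ A ∧ CountableIn M b ∧
      ∀ h, IsCohen b h → ∃ g ∈ D, IsCohen b g ∧ h ⊆ g := by
  have hω := hM.omega_mem
  have h2 := hM.two_mem
  obtain ⟨p, hp, hpm⟩ := hM.exists_cohen hA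
  -- Choose in M, for each condition on A, one extension in D.
  obtain ⟨c, hc, hcp⟩ := hM.exists_choice hp hD (r := fun h g => ∀ t ∈ h, t ∈ g)
    (by apply_rules (maxDepth := 1000) [Dfn.ball, Dfn.mem, Trm.var])
    fun h hh => hDA.2 h ((hpm h).1 hh)
  set K : ZFSet.{u} → ZFSet.{u} → Prop := fun h g =>
    g ∈ D ∧ (∀ t ∈ h, t ∈ g) ∧ ZFSet.pair h g ∈ c with hK
  have hKA : ∀ h g, K h g → IsCohen A g := fun h g hg => hDA.1 g hg.1
  have hfin := Level.finite (A := A) (K := K)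
    (fun h g g' hh hg hg' => (hcp h ((hpm h).2 hh)).unique hg hg') hKA
  have hLA : ∀ n a, Level A K n a → a ∈ A := by
    rintro n a ⟨-, -, -, hKg, ha⟩
    exact ((hKA _ _ hKg).mem_of_pair_mem ha).1
  -- `J s` says that each pair (n, a) in s is justified by pairs of lower level in s. The union of
  -- all such s ∈ M is the graph of the levels, which replaces an appeal to recursion inside M.
  set J : ZFSet.{u} → Prop := fun s => ∀ n ∈ ZFSet.omega, ∀ a ∈ A, ZFSet.pair n a ∈ s →
    ∃ m ∈ n, ∃ h ∈ p, (∀ b ∈ A, ∀ j ∈ ({numeral 0, numeral 1} : ZFSet.{u}),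
      ZFSet.pair b j ∈ h → ZFSet.pair m b ∈ s) ∧ ∃ g ∈ D,
      ((∀ t ∈ h, t ∈ g) ∧ ZFSet.pair h g ∈ c) ∧
        ∃ i ∈ ({numeral 0, numeral 1} : ZFSet.{u}), ZFSet.pair a i ∈ g with hJ
  set R := ZFSet.sep (fun q => ∃ s ∈ M, q ∈ s ∧ J s) (ZFSet.prod ZFSet.omega A) with hR
  have hRM : R ∈ M := by
    refine hM.sep_mem ?_ (hM.prod_mem hω hA)
    apply_rules (maxDepth := 1000) [Dfn.and, Dfn.imp, Dfn.ex, Dfn.bex, Dfn.ball, Dfn.mem,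
      Trm.var, Trm.pair, Trm.const]
  have hsound : ∀ s, J s → ∀ n, ∀ a ∈ A, ZFSet.pair (numeral n) a ∈ s → Level A K n a := by
    intro s hs n
    induction n using Nat.strong_induction_on with
    | _ n ih =>
    intro a ha has
    obtain ⟨_, hm, h, hh, hb, g, hg, ⟨hhg, hgc⟩, i, -, hi⟩ := hs _ (numeral_mem_omega n) a ha has
    obtain ⟨m, hmn, rfl⟩ := mem_numeral.1 hm
    have hhA := (hpm h).1 hh
    refine .step hmn hhA (fun b j hbj => ?_) ⟨hg, hhg, hgc⟩ hi
    have hbA := hhA.mem_of_pair_mem hbj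
    exact ih m hmn b hbA.1 (hb b hbA.1 j (mem_two.2 hbA.2) hbj)
  have hcomplete : ∀ n a, Level A K n a → ZFSet.pair (numeral n) a ∈ R := by
    intro n a hna
    -- The true levels up to n form a finite set of pairs, which is therefore an approximation
    -- belonging to M.
    obtain ⟨s, hs, e⟩ := hM.exists_coe_eq (Set.Finite.biUnion (Set.finite_Iic n) fun m _ =>
      (hfin m).image (ZFSet.pair (numeral m))) (by
        rintro q hq
        simp only [Set.mem_iUnion] at hq
        obtain ⟨m, -, b, hb, rfl⟩ := hq
        exact hM.pair_mem (hM.numeral_mem m) (hM.transitive _ hA _ (hLA _ _ hb)))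
    have hms : ∀ m b, ZFSet.pair (numeral m) b ∈ s ↔ m ≤ n ∧ Level A K m b := by
      intro m b
      rw [← SetLike.mem_coe, e]
      simp only [Set.mem_iUnion]
      constructor
      · rintro ⟨k, hk, b', hb', h⟩
        obtain ⟨h1, rfl⟩ := ZFSet.pair_inj.1 h
        obtain rfl := numeral_injective h1
        exact ⟨hk, hb'⟩
      · rintro ⟨hm, hb⟩
        exact ⟨m, hm, b, hb, rfl⟩
    refine ZFSet.mem_sep.2 ⟨ZFSet.pair_mem_prod.2 ⟨numeral_mem_omega n, hLA n a hna⟩, s, hs,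
      (hms _ _).2 ⟨le_rfl, hna⟩, ?_⟩
    intro k hk b hb hkb
    obtain ⟨k, rfl⟩ := mem_omega_iff.1 hk
    obtain ⟨hkn, hlt, hh, hm, hKg, hbg⟩ := (hms _ _).1 hkb
    exact ⟨_, numeral_mem_numeral.2 hlt, _, (hpm _).2 hh,
      fun b' _ j _ hbj => (hms _ _).2 ⟨hlt.le.trans hkn, hm b' j hbj⟩, _, hKg.1, hKg.2, _,
      mem_two.2 ((hKA _ _ hKg).mem_of_pair_mem hbg).2, hbg⟩
  have hmR : ∀ n a, ZFSet.pair (numeral n) a ∈ R ↔ Level A K n a := by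
    refine fun n a => ⟨fun h => ?_, hcomplete n a⟩
    obtain ⟨h1, s, -, h2, h3⟩ := ZFSet.mem_sep.1 h
    exact hsound s h3 n a (ZFSet.pair_mem_prod.1 h1).2 h2
  set b := ZFSet.sep (fun a => ∃ n ∈ ZFSet.omega, ZFSet.pair n a ∈ R) A with hb
  have hbM : b ∈ M := by
    refine hM.sep_mem ?_ hA
    apply_rules (maxDepth := 1000) [Dfn.bex, Dfn.mem, Trm.var, Trm.pair, Trm.const]
  have hmb : ∀ a, a ∈ b ↔ ∃ n, Level A K n a := by
    intro a
    rw [hb, ZFSet.mem_sep]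
    constructor
    · rintro ⟨-, _, hn, h⟩
      obtain ⟨n, rfl⟩ := mem_omega_iff.1 hn
      exact ⟨n, (hmR n a).1 h⟩
    · rintro ⟨n, h⟩
      exact ⟨hLA n a h, _, numeral_mem_omega n, (hmR n a).2 h⟩
  have hbA : b ⊆ A := ZFSet.sep_subset
  refine ⟨b, hbM, hbA, countableIn_of_levels hM hbM hRM (fun a ha => hAω a (hbA ha))
    (lev := fun n => {a | Level A K n a}) (fun m n hmn a ha => ha.mono hmn) hfin
    (fun n a _ => hmR n a) (fun a ha => (hmb a).1 ha), fun h hh => ?_⟩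
  have hhA : IsCohen A h := ⟨fun q hq => by
    obtain ⟨a, ha, i, hi, rfl⟩ := hh.exists_of_mem hq
    exact ZFSet.pair_mem_prod.2 ⟨hbA ha, mem_two.2 hi⟩, hh.2⟩
  -- The finite domain of h fits in one level n, so the chosen extension of h has its domain in
  -- level n + 1.
  obtain ⟨n, hn⟩ : ∃ n, ∀ a, (∃ i, ZFSet.pair a i ∈ h) → Level A K n a := by
    have hex : ∀ a : {a | ∃ i, ZFSet.pair a i ∈ h}, ∃ n, Level A K n a.1 := fun ⟨a, i, hi⟩ =>
      (hmb a).1 (hh.mem_of_pair_mem hi).1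
    choose f hf using hex
    have := (finite_setOf_pair_mem hh.2.1).to_subtype
    obtain ⟨n, hn⟩ := (Set.finite_range f).bddAbove
    exact ⟨n, fun a ha => (hf ⟨a, ha⟩).mono (hn ⟨_, rfl⟩)⟩
  obtain ⟨g, hg, -⟩ := hcp h ((hpm h).2 hhA)
  refine ⟨g, hg.1, ⟨fun q hq => ?_, (hKA h g hg).2⟩, fun q hq => hg.2.1 q hq⟩
  obtain ⟨a, -, i, hi, rfl⟩ := (hKA h g hg).exists_of_mem hq
  exact ZFSet.pair_mem_prod.2 ⟨(hmb a).2 ⟨n + 1, .step n.lt_succ_self hhA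
    (fun a j hj => hn a ⟨j, hj⟩) hg hq⟩, mem_two.2 hi⟩

/-! ### Transporting Cohen conditions -/

/-- The condition on `X` that arises from the condition `h` by pulling it back along `ρ`. -/
noncomputable def pullCohen (ρ : ZFSet.{u} → ZFSet.{u} → Prop) (X h : ZFSet.{u}) : ZFSet.{u} :=
  ZFSet.sep (fun q => ∃ a i n, q = ZFSet.pair a i ∧ ρ a n ∧ ZFSet.pair n i ∈ h)
    (ZFSet.prod X {numeral 0, numeral 1})

section Transport

variable {ρ : ZFSet.{u} → ZFSet.{u} → Prop} {X Y h : ZFSet.{u}}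

theorem pair_mem_pullCohen (hh : IsCohen Y h) {a i : ZFSet.{u}} :
    ZFSet.pair a i ∈ pullCohen ρ X h ↔ a ∈ X ∧ ∃ n, ρ a n ∧ ZFSet.pair n i ∈ h := by
  rw [pullCohen, ZFSet.mem_sep, ZFSet.pair_mem_prod]
  constructor
  · rintro ⟨⟨ha, -⟩, a', i', n, e, hn, hi⟩
    obtain ⟨rfl, rfl⟩ := ZFSet.pair_inj.1 e
    exact ⟨ha, n, hn, hi⟩
  · rintro ⟨ha, n, hn, hi⟩
    exact ⟨⟨ha, mem_two.2 (hh.mem_of_pair_mem hi).2⟩, a, i, n, rfl, hn, hi⟩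

/-- Injectivity of ρ keeps the pullback finite; single-valuedness of ρ makes it a function. -/
theorem isCohen_pullCohen (hh : IsCohen Y h) (hfun : ∀ a n n', ρ a n → ρ a n' → n = n')
    (hinj : ∀ a a' n, ρ a n → ρ a' n → a = a') : IsCohen X (pullCohen ρ X h) := by
  refine ⟨ZFSet.sep_subset, ?_, fun a i j hi hj => ?_⟩
  · have hex : ∀ q ∈ pullCohen ρ X h, ∃ p ∈ h, ∃ a i n, q = ZFSet.pair a i ∧ ρ a n ∧
        p = ZFSet.pair n i := by
      intro q hq
      obtain ⟨-, a, i, n, rfl, hn, hi⟩ := ZFSet.mem_sep.1 hq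
      exact ⟨_, hi, a, i, n, rfl, hn, rfl⟩
    choose! F hF hF' using hex
    refine Set.Finite.of_injOn (f := F) (fun q hq => hF q hq) (fun q hq q' hq' e => ?_) hh.2.1
    obtain ⟨a, i, n, rfl, hn, hi⟩ := hF' q hq
    obtain ⟨a', i', n', rfl, hn', hi'⟩ := hF' q' hq'
    obtain ⟨rfl, rfl⟩ := ZFSet.pair_inj.1 (hi.symm.trans (e.trans hi'))
    rw [hinj a a' n hn hn']
  · obtain ⟨-, n, hn, hi⟩ := (pair_mem_pullCohen hh).1 hi
    obtain ⟨-, n', hn', hj⟩ := (pair_mem_pullCohen hh).1 hj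
    obtain rfl := hfun a n n' hn hn'
    exact hh.2.2 n i j hi hj

end Transport

theorem IsCohen.subset_of_forall_pair {X h g : ZFSet.{u}} (hh : IsCohen X h)
    (H : ∀ a i, ZFSet.pair a i ∈ h → ZFSet.pair a i ∈ g) : h ⊆ g := by
  intro q hq
  obtain ⟨a, -, i, -, rfl⟩ := hh.exists_of_mem hq
  exact H a i hq

/-- Cohen preservation and countable covering: every dense subset in `W` of the Cohen poset of a
set of reals `A ∈ V` is refined by a dense subset in `V`. -/
theorem exists_refines_of_cohenPreserving {V W : Set ZFSet.{u}} (hV : IsTransitiveModel V)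
    (hW : IsTransitiveModel W) (hVW : V ⊆ W) {A : ZFSet.{u}} (hA : A ∈ V)
    (hAω : ∀ a ∈ A, a ⊆ ZFSet.omega) (hCohen : CohenPreserving V W)
    (hcov : CountableCovering V W A) {D : ZFSet.{u}} (hD : D ∈ W) (hDA : IsCohenDense A D) :
    ∃ C ∈ V, IsCohenDense A C ∧ Refines C D := by
  obtain ⟨b, hb, hbA, hbc, hbD⟩ := exists_countable_dense hW (hVW hA) hAω hD hDA
  obtain ⟨b', -, ⟨f, hf, hfun, hfinj⟩, hbb'⟩ := hcov b hb hbA hbc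
  have hωV := hV.omega_mem
  have h2V := hV.two_mem
  have hωW := hW.omega_mem
  have h2W := hW.two_mem
  have hfW := hVW hf
  have hAW := hVW hA
  have hfω : ∀ a n, ZFSet.pair a n ∈ f → n ∈ ZFSet.omega := fun a n h =>
    (ZFSet.pair_mem_prod.1 (hfun.1 h)).2
  have hfu : ∀ a n n', ZFSet.pair a n ∈ f → ZFSet.pair a n' ∈ f → n = n' := fun a n n' h h' =>
    (hfun.2 a (ZFSet.pair_mem_prod.1 (hfun.1 h)).1).unique h h'
  -- Conditions on ω that contain the full image under f of some g ∈ D; in particular dom g ⊆ dom f.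
  obtain ⟨D₁, hD₁, hmD₁⟩ := hW.sep_cohen_mem hωW (P := fun h => ∃ g ∈ D, ∀ a ∈ A,
      ∀ i ∈ ({numeral 0, numeral 1} : ZFSet.{u}), ZFSet.pair a i ∈ g →
        ∃ n ∈ ZFSet.omega, ZFSet.pair a n ∈ f ∧ ZFSet.pair n i ∈ h) (by
    clear hVW
    apply_rules (maxDepth := 1000) [Dfn.and, Dfn.imp, Dfn.bex hW, Dfn.ball hW, Dfn.mem,
      Trm.var, Trm.pair hW, Trm.const])
  have hD₁ω : IsCohenDense ZFSet.omega D₁ := by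
    refine ⟨fun h hh => ((hmD₁ h).1 hh).1, fun h hh => ?_⟩
    -- Pull h back to b, extend it there to g ∈ D, and push g forward. The image is compatible with
    -- h because g extends the pullback, and no part of g is lost because its domain lies in b.
    have hpull : IsCohen b (pullCohen (fun a n => ZFSet.pair a n ∈ f) b h) :=
      isCohen_pullCohen hh hfu fun a a' n => hfinj a a' n
    obtain ⟨g, hgD, hgb, hg⟩ := hbD _ hpull
    have hk : IsCohen ZFSet.omega (pullCohen (fun n a => ZFSet.pair a n ∈ f) ZFSet.omega g) :=
      isCohen_pullCohen hgb (fun n a a' => hfinj a a' n) fun n n' a => hfu a n n'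
    refine ⟨h ∪ pullCohen (fun n a => ZFSet.pair a n ∈ f) ZFSet.omega g,
      (hmD₁ _).2 ⟨hh.union hk ?_, g, hgD, ?_⟩, fun q hq => ZFSet.mem_union.2 (Or.inl hq)⟩
    · intro n i j hi hj
      obtain ⟨-, a, ha, hj⟩ := (pair_mem_pullCohen hgb).1 hj
      exact hgb.2.2 a i j (hg ((pair_mem_pullCohen hh).2
        ⟨(hgb.mem_of_pair_mem hj).1, n, ha, hi⟩)) hj
    · intro a _ i _ hi
      obtain ⟨n, hn, -⟩ := hfun.2 a (hbb' (hgb.mem_of_pair_mem hi).1)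
      exact ⟨n, hfω a n hn, hn, ZFSet.mem_union.2 (Or.inr ((pair_mem_pullCohen hgb).2
        ⟨hfω a n hn, a, hn, hi⟩))⟩
  obtain ⟨C, hC, hCω, hCD⟩ := hCohen D₁ hD₁ hD₁ω
  -- Conditions on A that contain the pullback of some g ∈ C. The part of g off f[A] is dropped,
  -- which costs nothing: the image of any k ∈ D witnessing membership in `D₁` lies in f[A].
  obtain ⟨C₂, hC₂, hmC₂⟩ := hV.sep_cohen_mem hA (P := fun h => ∃ g ∈ C, ∀ a ∈ A,
      ∀ n ∈ ZFSet.omega, ∀ i ∈ ({numeral 0, numeral 1} : ZFSet.{u}), ZFSet.pair a n ∈ f →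
        ZFSet.pair n i ∈ g → ZFSet.pair a i ∈ h) (by
    clear hVW
    apply_rules (maxDepth := 1000) [Dfn.and, Dfn.imp, Dfn.bex hV, Dfn.ball hV, Dfn.mem,
      Trm.var, Trm.pair hV, Trm.const])
  refine ⟨C₂, hC₂, ⟨fun h hh => ((hmC₂ h).1 hh).1, fun h hh => ?_⟩, fun h hh => ?_⟩
  · have hk : IsCohen ZFSet.omega (pullCohen (fun n a => ZFSet.pair a n ∈ f) ZFSet.omega h) :=
      isCohen_pullCohen hh (fun n a a' => hfinj a a' n) fun n n' a => hfu a n n'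
    obtain ⟨g, hgC, hg⟩ := hCω.2 _ hk
    have hgω := hCω.1 g hgC
    have hpull : IsCohen A (pullCohen (fun a n => ZFSet.pair a n ∈ f) A g) :=
      isCohen_pullCohen hgω hfu fun a a' n => hfinj a a' n
    refine ⟨h ∪ pullCohen (fun a n => ZFSet.pair a n ∈ f) A g,
      (hmC₂ _).2 ⟨hh.union hpull ?_, g, hgC, ?_⟩, fun q hq => ZFSet.mem_union.2 (Or.inl hq)⟩
    · intro a i j hi hj
      obtain ⟨-, n, hn, hj⟩ := (pair_mem_pullCohen hgω).1 hj
      exact hgω.2.2 n i j (hg ((pair_mem_pullCohen hh).2 ⟨hfω a n hn, a, hn, hi⟩)) hj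
    · intro a ha n _ i _ hn hi
      exact ZFSet.mem_union.2 (Or.inr ((pair_mem_pullCohen hgω).2 ⟨ha, n, hn, hi⟩))
  · obtain ⟨hhA, g, hgC, hg⟩ := (hmC₂ h).1 hh
    obtain ⟨d, hd, hdg⟩ := hCD g hgC
    obtain ⟨hdω, k, hkD, hk⟩ := (hmD₁ d).1 hd
    have hkA := hDA.1 k hkD
    refine ⟨k, hkD, hkA.subset_of_forall_pair fun a i hi => ?_⟩
    obtain ⟨haA, hi2⟩ := hkA.mem_of_pair_mem hi
    obtain ⟨n, hnω, hn, hni⟩ := hk a haA i (mem_two.2 hi2) hi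
    exact hg a haA n hnω i (mem_two.2 hi2) hn (hdg hni)

/-! ### The sets `A ^ h` -/

theorem cohenInter_anti {g h : ZFSet.{u}} (hgh : g ⊆ h) : cohenInter h ⊆ cohenInter g :=
  fun _ hn a => ⟨fun ha => (hn a).1 (hgh ha), fun ha => (hn a).2 (hgh ha)⟩

/-- `k ∈ A ^ h`, with the quantifiers bounded by `A`. -/
def InCohenInter (A h k : ZFSet.{u}) : Prop :=
  ∀ a ∈ A, (ZFSet.pair a (numeral 1) ∈ h → k ∈ a) ∧ (ZFSet.pair a (numeral 0) ∈ h → k ∉ a)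

theorem inCohenInter_numeral {A h : ZFSet.{u}} (hh : IsCohen A h) {n : ℕ} :
    InCohenInter A h (numeral n) ↔ n ∈ cohenInter h :=
  ⟨fun H a => ⟨fun ha => (H a (hh.mem_of_pair_mem ha).1).1 ha,
    fun ha => (H a (hh.mem_of_pair_mem ha).1).2 ha⟩, fun H a _ => H a⟩

theorem IsIndependent.infinite_cohenInter {A h : ZFSet.{u}} (hA : IsIndependent A)
    (hh : IsCohen A h) : (cohenInter h).Infinite := by
  classical
  refine (hA.2 (fun a => decide (ZFSet.pair a (numeral 1) ∈ h))
    ((fun a => if decide (ZFSet.pair a (numeral 1) ∈ h) = true then natSet a else (natSet a)ᶜ) ''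
      {a | ∃ i, ZFSet.pair a i ∈ h}) ?_ ((finite_setOf_pair_mem hh.2.1).image _)).mono ?_
  · rintro _ ⟨a, ⟨i, hi⟩, rfl⟩
    exact ⟨a, (hh.mem_of_pair_mem hi).1, rfl⟩
  · intro n hn a
    constructor <;> intro ha <;> have hna := hn _ ⟨a, ⟨_, ha⟩, rfl⟩
    · simpa [ha] using hna
    · have h1 : ZFSet.pair a (numeral 1) ∉ h := fun h1 =>
        absurd (numeral_injective (hh.2.2 a _ _ ha h1)) zero_ne_one
      simpa [h1] using hna

section Model

variable {M : Set ZFSet.{u}}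

theorem Dfn.inCohenInter (hM : IsTransitiveModel M) {n : ℕ}
    {T S : (Fin n → ZFSet.{u}) → ZFSet.{u}} {A : ZFSet.{u}} (hA : A ∈ M) (hT : Trm M T)
    (hS : Trm M S) : Dfn M fun v => InCohenInter A (T v) (S v) := by
  have h0 := hM.numeral_mem 0
  have h1 := hM.numeral_mem 1
  refine Dfn.subst₂ ?_ hT hS
  unfold InCohenInter
  apply_rules (maxDepth := 1000) [Dfn.not, Dfn.and, Dfn.imp, Dfn.ball, Dfn.mem, Trm.var,
    Trm.pair, Trm.const]

/-- A definable set of natural numbers belongs to `M`. -/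
theorem IsTransitiveModel.exists_natSet_eq (hM : IsTransitiveModel M) {P : ZFSet.{u} → Prop}
    (hP : Dfn M fun v : Fin 1 → ZFSet.{u} => P (v 0)) :
    ∃ x ∈ M, x ⊆ ZFSet.omega ∧ natSet x = {n | P (numeral n)} :=
  ⟨_, hM.sep_mem hP hM.omega_mem, ZFSet.sep_subset, Set.ext fun n =>
    ZFSet.mem_sep.trans (and_iff_right (numeral_mem_omega n))⟩

theorem IsTransitiveModel.exists_natSet_eq_cohenInter (hM : IsTransitiveModel M) {A h : ZFSet.{u}}
    (hA : A ∈ M) (hh : IsCohen A h) :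
    ∃ x ∈ M, x ⊆ ZFSet.omega ∧ natSet x = cohenInter h := by
  obtain ⟨x, hx, hxω, e⟩ := hM.exists_natSet_eq (P := InCohenInter A h)
    (Dfn.inCohenInter hM hA (Trm.const (hh.mem hM hA)) (Trm.var 0))
  exact ⟨x, hx, hxω, e.trans (Set.ext fun n => inCohenInter_numeral hh)⟩

theorem IsTransitiveModel.exists_natSet_eq_of_finite_compl (hM : IsTransitiveModel M) {S : Set ℕ}
    (hS : Sᶜ.Finite) : ∃ x ∈ M, x ⊆ ZFSet.omega ∧ natSet x = S := by
  obtain ⟨y, hy, e⟩ := hM.exists_coe_eq (hS.image numeral) (by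
    rintro _ ⟨n, -, rfl⟩
    exact hM.numeral_mem n)
  obtain ⟨x, hx, hxω, e'⟩ := hM.exists_natSet_eq (P := fun k => k ∉ y)
    (Dfn.mem (Trm.var 0) (Trm.const hy)).not
  refine ⟨x, hx, hxω, e'.trans (Set.ext fun n => ?_)⟩
  rw [Set.mem_ofPred_eq, ← SetLike.mem_coe, e, numeral_injective.mem_set_image, Set.mem_compl_iff,
    not_not]

/-! ### The density filter -/

/-- For intersections, extend twice: a longer condition has a smaller A^g. With independence, this
makes each A^h positive for the filter. -/
theorem exists_cohenInter_subset {A : ZFSet.{u}} {S : Set ℕ} (hS : S ∈ densityFilter M A) :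
    ∀ h, IsCohen A h → ∃ g, IsCohen A g ∧ h ⊆ g ∧ cohenInter g ⊆ S := by
  induction hS with
  | basic hs =>
    obtain ⟨D, -, hD, rfl⟩ := hs
    intro h hh
    obtain ⟨g, hg, hhg⟩ := hD.2 h hh
    exact ⟨g, hD.1 g hg, hhg, fun n hn => ⟨g, hg, hn⟩⟩
  | univ => exact fun h hh => ⟨h, hh, fun _ => id, Set.subset_univ _⟩
  | superset _ hst ih =>
    intro h hh
    obtain ⟨g, hg, hhg, hgs⟩ := ih h hh
    exact ⟨g, hg, hhg, hgs.trans hst⟩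
  | inter _ _ ih₁ ih₂ =>
    intro h hh
    obtain ⟨g, hg, hhg, hgs⟩ := ih₁ h hh
    obtain ⟨k, hk, hgk, hks⟩ := ih₂ g hg
    exact ⟨k, hk, fun _ hq => hgk (hhg hq), Set.subset_inter ((cohenInter_anti hgk).trans hgs) hks⟩

/-- Refining a dense set shrinks the generator ⋃ A^h, so the generators from V are cofinal among
those from W. -/
theorem densityFilter_eq {V W : Set ZFSet.{u}} (hVW : V ⊆ W) {A : ZFSet.{u}}
    (hD : ∀ D ∈ W, IsCohenDense A D → ∃ C ∈ V, IsCohenDense A C ∧ Refines C D) :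
    densityFilter W A = densityFilter V A := by
  refine le_antisymm (Filter.le_generate_iff.2 ?_) (Filter.le_generate_iff.2 ?_)
  · rintro _ ⟨D, hDV, hDA, rfl⟩
    exact Filter.mem_generate_of_mem ⟨D, hVW hDV, hDA, rfl⟩
  · rintro _ ⟨D, hDW, hDA, rfl⟩
    obtain ⟨C, hC, hCA, hCD⟩ := hD D hDW hDA
    refine Filter.mem_of_superset (Filter.mem_generate_of_mem ⟨C, hC, hCA, rfl⟩) ?_
    rintro n ⟨h, hh, hn⟩
    obtain ⟨g, hg, hgh⟩ := hCD h hh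
    exact ⟨g, hg, cohenInter_anti hgh hn⟩

/-! ### Free sequences -/

theorem subset_omega_of_isFunc {γ B α a : ZFSet.{u}}
    (hB : ZFSet.IsFunc γ (ZFSet.powerset ZFSet.omega) B) (ha : ZFSet.pair α a ∈ B) :
    α ∈ γ ∧ a ⊆ ZFSet.omega := by
  have := ZFSet.pair_mem_prod.1 (hB.1 ha)
  exact ⟨this.1, ZFSet.mem_powerset.1 this.2⟩

/-- Association compares only sets in M, but both filters have all their generators in M, so they
agree on every subset of ω and the equality can be used outside M. -/
theorem IsAssociated.sequenceFilter_eq (hM : IsTransitiveModel M) {A γ B : ZFSet.{u}} (hA : A ∈ M)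
    (hB : B ∈ M) (h : IsAssociated M A γ B) : sequenceFilter B = densityFilter M A := by
  refine le_antisymm (Filter.le_generate_iff.2 ?_) (Filter.le_generate_iff.2 ?_)
  · rintro _ ⟨D, hD, hDA, rfl⟩
    obtain ⟨x, hx, hxω, e⟩ := hM.exists_natSet_eq (P := fun k => ∃ h ∈ D, InCohenInter A h k) (by
      apply_rules (maxDepth := 1000) [Dfn.bex, Dfn.inCohenInter, Trm.var, Trm.const])
    have e : natSet x = {n | ∃ h ∈ D, n ∈ cohenInter h} := e.trans (Set.ext fun n =>
      exists_congr fun h => and_congr_right fun hh => inCohenInter_numeral (hDA.1 h hh))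
    have h1 := (h.2 x hx hxω).2
    rw [e] at h1
    exact h1 (Filter.mem_generate_of_mem ⟨D, hD, hDA, rfl⟩)
  · rintro S hS
    obtain ⟨x, hx, hxω, rfl⟩ : ∃ x ∈ M, x ⊆ ZFSet.omega ∧ natSet x = S := by
      rcases hS with ⟨α, a, ha, rfl⟩ | hS
      · exact ⟨a, (hM.mem_of_pair_mem (hM.transitive _ hB _ ha)).2,
          (subset_omega_of_isFunc h.1.1.2.1 ha).2, rfl⟩
      · exact hM.exists_natSet_eq_of_finite_compl hS
    exact (h.2 x hx hxω).1 (Filter.mem_generate_of_mem hS)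

theorem exists_sInter_diff_finite {B : ZFSet.{u}} {S : Set ℕ} (hS : S ∈ sequenceFilter B) :
    ∃ T ⊆ {s | ∃ α a, ZFSet.pair α a ∈ B ∧ s = natSet a}, T.Finite ∧ (⋂₀ T \ S).Finite := by
  induction hS with
  | @basic s hs =>
    rcases hs with hs | hs
    · exact ⟨{s}, Set.singleton_subset_iff.2 hs, Set.finite_singleton s, by simp⟩
    · exact ⟨∅, Set.empty_subset _, Set.finite_empty, hs.subset fun n hn => hn.2⟩
  | univ => exact ⟨∅, Set.empty_subset _, Set.finite_empty, by simp⟩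
  | superset _ hst ih =>
    obtain ⟨T, hT, hTf, h⟩ := ih
    exact ⟨T, hT, hTf, h.subset (Set.sdiff_subset_sdiff_right hst)⟩
  | inter _ _ ih₁ ih₂ =>
    obtain ⟨T, hT, hTf, h⟩ := ih₁
    obtain ⟨T', hT', hTf', h'⟩ := ih₂
    refine ⟨T ∪ T', Set.union_subset hT hT', hTf.union hTf', (h.union h').subset ?_⟩
    rintro n ⟨hn, hns⟩
    rw [Set.sInter_union] at hn
    by_contra hcon
    simp only [Set.mem_union, Set.mem_sdiff, not_or, not_and, not_not] at hcon
    exact hns ⟨hcon.1 hn.1, hcon.2 hn.2⟩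

theorem isFunc_insert_pair {γ Y B X : ZFSet.{u}} (hB : ZFSet.IsFunc γ Y B) (hX : X ∈ Y) :
    ZFSet.IsFunc (insert γ γ) Y (insert (ZFSet.pair γ X) B) := by
  refine ⟨fun p hp => ?_, fun α hα => ?_⟩
  · rcases ZFSet.mem_insert_iff.1 hp with rfl | hp
    · exact ZFSet.pair_mem_prod.2 ⟨ZFSet.mem_insert _ _, hX⟩
    · obtain ⟨α, hα, a, ha, rfl⟩ := ZFSet.mem_prod.1 (hB.1 hp)
      exact ZFSet.pair_mem_prod.2 ⟨ZFSet.mem_insert_of_mem _ hα, ha⟩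
  · have hγ : ∀ a, ZFSet.pair γ a ∉ B := fun a ha =>
      ZFSet.mem_irrefl γ (ZFSet.pair_mem_prod.1 (hB.1 ha)).1
    rcases ZFSet.mem_insert_iff.1 hα with rfl | hα
    · refine ⟨X, ZFSet.mem_insert _ _, fun a ha => ?_⟩
      rcases ZFSet.mem_insert_iff.1 ha with h | h
      exacts [(ZFSet.pair_inj.1 h).2, absurd h (hγ a)]
    · obtain ⟨a, ha, hu⟩ := hB.2 α hα
      refine ⟨a, ZFSet.mem_insert_of_mem _ ha, fun a' ha' => ?_⟩
      rcases ZFSet.mem_insert_iff.1 ha' with h | h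
      · rw [(ZFSet.pair_inj.1 h).1] at hα
        exact absurd hα (ZFSet.mem_irrefl γ)
      · exact hu a' h

/-- If `X` end-extends the free sequence `B`, so does each `Y ⊆* X` that is positive for the filter
generated by `B`. -/
theorem IsFreeSequence.insert_of_subset {γ B X Y : ZFSet.{u}} (hB : IsFreeSequence γ B)
    (hX : IsFreeSequence (insert γ γ) (insert (ZFSet.pair γ X) B)) (hYω : Y ⊆ ZFSet.omega)
    (hYX : (natSet Y \ natSet X).Finite)
    (hY : ∀ S ∈ sequenceFilter B, (S ∩ natSet Y).Infinite) :
    IsFreeSequence (insert γ γ) (insert (ZFSet.pair γ Y) B) := by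
  refine ⟨hX.1, isFunc_insert_pair hB.2.1 (ZFSet.mem_powerset.2 hYω), fun β hβ T hT hTf => ?_⟩
  have hBγ : ∀ α a, ZFSet.pair α a ∈ B → α ∈ γ := fun α a h =>
    (subset_omega_of_isFunc hB.2.1 h).1
  by_cases hγβ : γ ∈ β
  · have hβ : β = insert γ γ := by
      refine hβ.resolve_left fun h => ?_
      rcases ZFSet.mem_insert_iff.1 h with rfl | h
      exacts [ZFSet.mem_irrefl _ hγβ, ZFSet.mem_asymm h hγβ]
    have hS : ⋂₀ (T \ {natSet Y}) ∈ sequenceFilter B := by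
      refine (Filter.sInter_mem (hTf.subset Set.sdiff_subset)).2 fun s hs => ?_
      obtain ⟨α, a, ha, h⟩ := hT hs.1
      rcases ZFSet.mem_insert_iff.1 ha with h' | h'
      · obtain ⟨rfl, rfl⟩ := ZFSet.pair_inj.1 h'
        rcases h with ⟨-, rfl⟩ | ⟨h, -⟩
        exacts [absurd rfl hs.2, absurd hγβ h]
      · rcases h with ⟨-, rfl⟩ | ⟨h, -⟩
        · exact Filter.mem_generate_of_mem (Or.inl ⟨α, a, h', rfl⟩)
        · rw [hβ] at h
          exact absurd (ZFSet.mem_insert_of_mem _ (hBγ α a h')) h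
    refine (hY _ hS).mono fun n hn s hs => ?_
    by_cases hsY : s = natSet Y
    · rw [hsY]
      exact hn.2
    · exact hn.1 s ⟨hs, hsY⟩
  -- Here the last term is complemented. As ω \ X ⊆* ω \ Y, freeness for X in place of Y suffices.
  · have hinf := hX.2.2 β hβ (insert (natSet X)ᶜ (T \ {(natSet Y)ᶜ})) (by
      refine Set.insert_subset ⟨γ, X, ZFSet.mem_insert _ _, Or.inr ⟨hγβ, rfl⟩⟩ fun s hs => ?_
      obtain ⟨α, a, ha, h⟩ := hT hs.1
      rcases ZFSet.mem_insert_iff.1 ha with h' | h'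
      · obtain ⟨rfl, rfl⟩ := ZFSet.pair_inj.1 h'
        rcases h with ⟨h, -⟩ | ⟨-, rfl⟩
        exacts [absurd h hγβ, absurd rfl hs.2]
      · exact ⟨α, a, ZFSet.mem_insert_of_mem _ h', h⟩) ((hTf.subset Set.sdiff_subset).insert _)
    refine (hinf.sdiff hYX).mono ?_
    rintro n ⟨hn, hnYX⟩ s hs
    by_cases hsY : s = (natSet Y)ᶜ
    · rw [hsY]
      exact fun hnY => hnYX ⟨hnY, hn _ (Set.mem_insert _ _)⟩
    · exact hn s (Set.mem_insert_of_mem _ ⟨hs, hsY⟩)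

end Model

/-! ### Maximality and association in the extension -/

theorem mainTheorem5 (V W : Set ZFSet.{u}) (hV : IsTransitiveModel V) (hW : IsTransitiveModel W)
    (hVW : V ⊆ W) (A γ B : ZFSet.{u}) (hA : A ∈ V) (hB : B ∈ V)
    (hAV : IsDenseSystem V A) (hBV : IsAssociated V A γ B)
    (hCohen : CohenPreserving V W) (hcov : CountableCovering V W A)
    (hAW : IsDenseSystem W A) :
    IsAssociated W A γ B := by
  have hWV : densityFilter W A = densityFilter V A := densityFilter_eq hVW fun D hD hDA =>
    exists_refines_of_cohenPreserving hV hW hVW hA (fun a ha => (hAV.1.1 a ha).1) hCohen hcov hD hDA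
  have hseq : sequenceFilter B = densityFilter V A := hBV.sequenceFilter_eq hV hA hB
  refine ⟨⟨hBV.1.1, fun X hX hXω hfree => ?_⟩, fun X _ _ => by rw [hseq, hWV]⟩
  obtain ⟨h, hh, hhX⟩ : ∃ h, IsCohen A h ∧ (cohenInter h \ natSet X).Finite := by
    by_contra! hcon
    have hAW' := hVW hA
    obtain ⟨D, hD, hmD⟩ := hW.sep_cohen_mem hAW' (P := fun h => ∀ k ∈ X, ¬ InCohenInter A h k) (by
      clear hVW
      apply_rules (maxDepth := 1000) [Dfn.inCohenInter hW, Dfn.not, Dfn.ball hW, Trm.var, Trm.const])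
    have hDA : IsCohenDense A D := by
      refine ⟨fun h hh => ((hmD h).1 hh).1, fun h hh => ?_⟩
      obtain ⟨g, hg, hhg, hgX⟩ := hAW.2 X hX hXω h hh
      have hfin := hgX.resolve_left (hcon g hg)
      -- Cofinite sets lie in F_A because B generates it, so a further extension k of g avoids the
      -- finite set A^g ∩ X and makes A^k truly disjoint from X.
      have hcof : (cohenInter g ∩ natSet X)ᶜ ∈ densityFilter V A := by
        rw [← hseq]
        exact Filter.mem_generate_of_mem (Or.inr (by rwa [Set.mem_ofPred_eq, compl_compl]))
      obtain ⟨k, hk, hgk, hkX⟩ := exists_cohenInter_subset hcof g hg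
      refine ⟨k, (hmD k).2 ⟨hk, fun j hj hjk => ?_⟩, fun q hq => hgk (hhg hq)⟩
      obtain ⟨n, rfl⟩ := mem_omega_iff.1 (hXω hj)
      have hn := (inCohenInter_numeral hk).1 hjk
      exact hkX hn ⟨cohenInter_anti hgk hn, hj⟩
    have hXc : (natSet X)ᶜ ∈ sequenceFilter B := by
      rw [hseq, ← hWV]
      refine Filter.mem_of_superset (Filter.mem_generate_of_mem ⟨D, hD, hDA, rfl⟩) ?_
      rintro n ⟨h, hh, hn⟩ hnX
      obtain ⟨hhA, hhX⟩ := (hmD h).1 hh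
      exact hhX _ hnX ((inCohenInter_numeral hhA).2 hn)
    obtain ⟨T, hT, hTf, hTX⟩ := exists_sInter_diff_finite hXc
    -- Take β = γ + 1: the finitely many terms in T together with X would have finite intersection.
    refine hfree.2.2 _ (Or.inr rfl) (insert (natSet X) T) ?_ (hTf.insert _) (hTX.subset ?_)
    · refine Set.insert_subset ⟨γ, X, ZFSet.mem_insert _ _, Or.inl ⟨ZFSet.mem_insert _ _, rfl⟩⟩ ?_
      intro s hs
      obtain ⟨α, a, ha, rfl⟩ := hT hs
      exact ⟨α, a, ZFSet.mem_insert_of_mem _ ha, Or.inl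
        ⟨ZFSet.mem_insert_of_mem _ (subset_omega_of_isFunc hBV.1.1.2.1 ha).1, rfl⟩⟩
    · intro n hn
      rw [Set.sInter_insert] at hn
      exact ⟨hn.2, not_not.2 hn.1⟩
  -- The condition h is a finite object over A ∈ V, so A^h belongs to V.
  obtain ⟨Y, hY, hYω, hYh⟩ := hV.exists_natSet_eq_cohenInter hA hh
  refine hBV.1.2 Y hY hYω (hBV.1.1.insert_of_subset hfree hYω (by rwa [hYh]) fun S hS => ?_)
  rw [hseq] at hS
  obtain ⟨g, hg, hhg, hgS⟩ := exists_cohenInter_subset hS h hh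
  rw [hYh]
  exact (hAV.1.infinite_cohenInter hg).mono (Set.subset_inter hgS (cohenInter_anti hhg))
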